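/- Let $n\ge 1$ and let $\alpha=(\alpha_1,\dots,\alpha_n)$, $\beta=(\beta_1,\dots,\beta_n)\in\mathbb C^n$ satisfy $\Re\alpha_j+\Re\beta_j>-1$ and $\alpha_j,\beta_j\notin\{-1,-2,\dots\}$ for all $1\le j\le n$. Let $\mathbb D^n$ be the open unit polydisc in $\mathbb C^n$, $\mathbb T^n$ the unit torus and $m_n$ its normalized Haar measure; all $L^p(\mathbb T^n)$ norms $\|\cdot\|_p$ are taken with respect to $m_n$. A function $u\in C^2(\mathbb D^n)$ is called separately $(\alpha,\beta)$-harmonic if for every $1\le j\le n$ $$(1-|z_j|^2)\frac{\partial^2u}{\partial z_j\partial\overline{z_j}}+\alpha_jz_j\frac{\partial u}{\partial z_j}+\beta_j\overline{z_j}\frac{\partial u}{\partial\overline{z_j}}-\alpha_j\beta_ju=0\quad\text{in }\mathbb D^n .$$ For $\mathbf r\in[0,1)^n$ put $u_{\mathbf r}(\zeta)=u(r_1\zeta_1,\dots,r_n\zeta_n)$, $\zeta\in\mathbb T^n$. For $1\le p<\infty$ let $\|u\|_{\alpha,\beta;p}=\sup_{\mathbf r\in[0,1)^n}\|u_{\mathbf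 r}\|_{p}$, and let $\|u\|_{\alpha,\beta;\infty}=\sup_{z\in\mathbb D^n}|u(z)|$. For $1\le p\le\infty$ the space $sh^p_{\alpha,\beta}(\mathbb D^n)$ consists of all separately $(\alpha,\beta)$-harmonic $u$ with $\|u\|_{\alpha,\beta;p}<\infty$. For $\psi\in L^1(\mathbb T^n)$ and $z\in\mathbb D^n$ let $P_{\alpha,\beta}[\psi](z)=\int_{\mathbb T^n}P_{\alpha,\beta}(z,\zeta)\psi(\zeta)\,dm_n(\zeta)$, where (with principal powers) $$P_{\alpha,\beta}(z,\zeta)=\prod_{j=1}^n\frac{\Gamma(\alpha_j+1)\Gamma(\beta_j+1)}{\Gamma(\alpha_j+\beta_j+1)}\,\frac{(1-|z_j|^2)^{\alpha_j+\beta_j+1}}{(1-z_j\overline{\zeta_j})^{\alpha_j+1}(1-\overline{z_j}\zeta_j)^{\beta_j+1}},$$ and let $$K(\alpha,\beta)=e^{\frac\pi2\sum_{j=1}^n|\Im\alpha_j-\Im\beta_j|}\prod_{j=1}^n\left|\frac{\Gamma(\alpha_j+1)\Gamma(\beta_j+1)}{\Gamma(\alpha_j+\beta_j+1)}\right|\frac{\Gamma(\Re\alpha_j+\Re\beta_j+1)}{\Gamma^2\!\left(\frac{\Re\alpha_j+\Re\beta_j}{2}+1\right)}.$$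 **Theorem.** If $\psi\in L^p(\mathbb T^n)$ for some $1\le p\le\infty$, then $P_{\alpha,\beta}[\psi]\in sh^p_{\alpha,\beta}(\mathbb D^n)$ and $$\|P_{\alpha,\beta}[\psi]\|_{\alpha,\beta;p}\le K(\alpha,\beta)\,\|\psi\|_p .$$ If moreover $p<\infty$, then $$\lim_{\mathbf r\to\mathbf 1,\ \mathbf r\in[0,1)^n}\big\|(P_{\alpha,\beta}[\psi])_{\mathbf r}-\psi\big\|_{L^p(\mathbb T^n)}=0 ,$$ where $\mathbf 1=(1,\dots,1)$ and $\mathbf r$ tends to $\mathbf 1$ without any restriction on the relative rates of its coordinates. -/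

import Mathlib

open MeasureTheory Filter Topology
open scoped ENNReal

noncomputable section

/-- The unit circle carries its Borel σ-algebra. -/
instance instMeasurableSpaceCircle : MeasurableSpace Circle := borel Circle

instance instBorelSpaceCircle : BorelSpace Circle := ⟨rfl⟩

namespace SepHarm

variable {n : ℕ}

/-- The torus `𝕋ⁿ`, the distinguished boundary of the polydisc. -/
abbrev Torus (n : ℕ) : Type := Fin n → Circle

/-- The normalized Haar measure on the circle: the Haar measure giving the whole circle mass one. -/
def circleHaar : Measure Circle := Measure.haarMeasure ⊤

/-- The normalized Haar measure `m_n` on `𝕋ⁿ`. -/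
def torusHaar (n : ℕ) : Measure (Torus n) := Measure.pi fun _ => circleHaar

/-- The open unit polydisc `𝔻ⁿ`. -/
def polydisc (n : ℕ) : Set (Fin n → ℂ) := {z | ∀ j, ‖z j‖ < 1}

/-- The set `[0,1)ⁿ` of multi-radii. -/
def multiRadii (n : ℕ) : Set (Fin n → ℝ) := {r | ∀ j, 0 ≤ r j ∧ r j < 1}

/-- `∂u/∂z_j = (∂u/∂x_j - i ∂u/∂y_j) / 2`, where `z_j = x_j + i y_j`. -/
def wirtinger (j : Fin n) (u : (Fin n → ℂ) → ℂ) (z : Fin n → ℂ) : ℂ :=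
  (lineDeriv ℝ u z (Pi.single j 1) - Complex.I * lineDeriv ℝ u z (Pi.single j Complex.I)) / 2

/-- `∂u/∂z̄_j = (∂u/∂x_j + i ∂u/∂y_j) / 2`, where `z_j = x_j + i y_j`. -/
def wirtingerBar (j : Fin n) (u : (Fin n → ℂ) → ℂ) (z : Fin n → ℂ) : ℂ :=
  (lineDeriv ℝ u z (Pi.single j 1) + Complex.I * lineDeriv ℝ u z (Pi.single j Complex.I)) / 2

/-- The operator
`(1 - |z_j|²) ∂²/∂z_j∂z̄_j + a z_j ∂/∂z_j + b z̄_j ∂/∂z̄_j - a b` acting in the variable `z_j`. -/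
def opL (a b : ℂ) (j : Fin n) (u : (Fin n → ℂ) → ℂ) (z : Fin n → ℂ) : ℂ :=
  ((1 - ‖z j‖ ^ 2 : ℝ) : ℂ) * wirtinger j (wirtingerBar j u) z
    + a * z j * wirtinger j u z
    + b * (starRingEnd ℂ) (z j) * wirtingerBar j u z
    - a * b * u z

/-- `u` is separately `(α, β)`-harmonic in the polydisc: it is of class `C²` there (in the real
sense) and is annihilated there by each of the `n` operators. Values outside the polydisc play
no role. -/
def IsSepHarmonic (α β : Fin n → ℂ) (u : (Fin n → ℂ) → ℂ) : Prop :=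
  ContDiffOn ℝ 2 u (polydisc n) ∧
    ∀ j : Fin n, ∀ z ∈ polydisc n, opL (α j) (β j) j u z = 0

/-- The function `u_r(ζ) = u(r_1 ζ_1, …, r_n ζ_n)` on the torus. -/
def dilate (r : Fin n → ℝ) (u : (Fin n → ℂ) → ℂ) (ζ : Torus n) : ℂ :=
  u fun j => (r j : ℂ) * (ζ j : ℂ)

/-- The norm of `sh^p`, with values in `[0, ∞]`: for `p < ∞` the supremum over all multi-radii of
the `L^p(𝕋ⁿ)` norms of `u_r`, for `p = ∞` the supremum of `|u|` over the polydisc. -/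
def shNorm (p : ℝ≥0∞) (u : (Fin n → ℂ) → ℂ) : ℝ≥0∞ :=
  if p = ∞ then ⨆ z ∈ polydisc n, ‖u z‖ₑ
  else ⨆ r ∈ multiRadii n, eLpNorm (dilate r u) p (torusHaar n)

/-- The space `sh^p_{α,β}(𝔻ⁿ)`: separately `(α, β)`-harmonic functions of finite norm. -/
def sh (α β : Fin n → ℂ) (p : ℝ≥0∞) : Set ((Fin n → ℂ) → ℂ) :=
  {u | IsSepHarmonic α β u ∧ shNorm p u < ∞}

/-- The constant `c_{a,b} = Γ(a+1) Γ(b+1) / Γ(a+b+1)`. -/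
def coef (a b : ℂ) : ℂ :=
  Complex.Gamma (a + 1) * Complex.Gamma (b + 1) / Complex.Gamma (a + b + 1)

/-- The `(α, β)`-Poisson kernel. All powers are principal; the bases have positive real part for
`z` in the polydisc. -/
def poissonKernel (α β : Fin n → ℂ) (z : Fin n → ℂ) (ζ : Torus n) : ℂ :=
  ∏ j, coef (α j) (β j) *
    (((1 - ‖z j‖ ^ 2 : ℝ) : ℂ) ^ (α j + β j + 1) /
      ((1 - z j * (starRingEnd ℂ) (ζ j : ℂ)) ^ (α j + 1) *
        (1 - (starRingEnd ℂ) (z j) * (ζ j : ℂ)) ^ (β j + 1)))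

/-- The `(α, β)`-Poisson integral of a function on the torus. -/
def poissonIntegral (α β : Fin n → ℂ) (ψ : Torus n → ℂ) (z : Fin n → ℂ) : ℂ :=
  ∫ ζ, poissonKernel α β z ζ * ψ ζ ∂(torusHaar n)

/-- The constant `K(α, β)`. -/
def constK (α β : Fin n → ℂ) : ℝ :=
  Real.exp (Real.pi / 2 * ∑ j, |(α j).im - (β j).im|) *
    ∏ j, ‖Complex.Gamma (α j + 1) * Complex.Gamma (β j + 1) / Complex.Gamma (α j + β j + 1)‖ *
      (Real.Gamma ((α j).re + (β j).re + 1) /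
        Real.Gamma (((α j).re + (β j).re) / 2 + 1) ^ 2)

end SepHarm

end

/-! Rotation invariance of the kernel and of Haar measure turns the dilate of a Poisson integral
into a convolution on the group $\mathbb T^n$ (`dilate_poissonIntegral`): its value at $\zeta$ is
$\int k_r(\xi)\psi(\zeta\xi)\,dm_n(\xi)$ with $k_r$ the kernel at the point $r$. The theorem then
follows from four facts about $k_r$, each reduced to one variable by the product structure.

Equation: $\partial\bar\partial$ of a one-variable factor, divided by the factor, is rational in
$z,\bar z,\xi$, and the equation is an algebraic identity (`kernel_annihilated`). The kernel is
smooth jointly in both variables and the torus is compact, so the operators pass under the integral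
(`opL_integral`).

Norm: with $s=\Re a+\Re b$ the factor is at most $|c_{a,b}|e^{\frac\pi2|\Im a-\Im
b|}(1-r^2)^{s+1}|1-r\bar\xi|^{-s-2}$. Binomial expansion and orthogonality make the integral of the
last power a series with coefficients $((h)_k/k!)^2$, $h=s/2+1$, which are compared termwise with
those of $(1-r^2)^{-(s+1)}$ (`risingCoeff_sq_le`). Hence $\|k_r\|_1\le K(\alpha,\beta)$, and Young's
inequality gives the bound.

Mass: the integral of a factor is $c_{a,b}(1-x)^{a+b+1}F(a+1,b+1;1;x)$ at $x=r^2$. In general it is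
not $1$, but it tends to $1$ by the asymptotics of the coefficients
(`tendsto_cpow_mul_tsum_risingCoeff`).

Concentration: away from $\xi=1$ a factor is $O((1-r^2)^{s+1})$, while the other factors keep
bounded $L^1$ norms; no relation between the radii is needed.

So $k_r$ is an approximate identity. Convergence is uniform for continuous functions and passes to
$L^p$, $p<\infty$, by density. -/

noncomputable section

namespace SepHarm

/-! ### Binomial coefficients and Euler's limit formula -/

/-- The coefficient `(a)_k / k!` of `x ^ k` in the binomial series of `(1 - x) ^ (-a)`. -/
def risingCoeff {K : Type*} [Field K] (a : K) (k : ℕ) : K :=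
  ∏ i ∈ Finset.range k, (a + i) / (i + 1)

lemma risingCoeff_succ {K : Type*} [Field K] (a : K) (k : ℕ) :
    risingCoeff a (k + 1) = risingCoeff a k * ((a + k) / (k + 1)) :=
  Finset.prod_range_succ _ _

lemma risingCoeff_pos {a : ℝ} (ha : 0 < a) (k : ℕ) : 0 < risingCoeff a k :=
  Finset.prod_pos fun i _ => by positivity

lemma risingCoeff_ofReal (a : ℝ) (k : ℕ) :
    risingCoeff (a : ℂ) k = ((risingCoeff a k : ℝ) : ℂ) := by
  simp [risingCoeff]

lemma risingCoeff_eq_choose (a : ℂ) (k : ℕ) :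
    risingCoeff a k = Ring.choose (a + k - 1) k := by
  rw [← Ring.multichoose_eq]
  have h := Ring.factorial_nsmul_multichoose_eq_ascPochhammer a k
  rw [Polynomial.ascPochhammer_smeval_eq_eval] at h
  have hk : (k.factorial : ℂ) ≠ 0 := by exact_mod_cast k.factorial_ne_zero
  have h2 : (k.factorial : ℂ) * risingCoeff a k = (ascPochhammer ℂ k).eval a := by
    clear h hk
    induction k with
    | zero => simp [risingCoeff]
    | succ k ih =>
      rw [risingCoeff_succ, ascPochhammer_succ_eval, ← ih, Nat.factorial_succ]
      have : (k : ℂ) + 1 ≠ 0 := by exact_mod_cast k.succ_ne_zero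
      push_cast
      field_simp
  rw [nsmul_eq_mul, ← h2] at h
  exact (mul_left_cancel₀ hk h).symm

lemma hasSum_risingCoeff (a : ℂ) {x : ℂ} (hx : ‖x‖ < 1) :
    HasSum (fun k => risingCoeff a k * x ^ k) ((1 - x) ^ (-a)) := by
  have h := (Complex.one_div_one_sub_cpow_hasFPowerSeriesOnBall_zero a).hasSum (y := x)
    (by rw [← ENNReal.ofReal_one, Metric.eball_ofReal]; simpa using hx)
  simpa [FormalMultilinearSeries.ofScalars_apply_eq, Complex.cpow_neg, risingCoeff_eq_choose,
    mul_comm] using h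

lemma summable_norm_risingCoeff (a : ℂ) {x : ℂ} (hx : ‖x‖ < 1) :
    Summable fun k => ‖risingCoeff a k * x ^ k‖ :=
  (hasSum_risingCoeff a hx).summable.norm

lemma hasSum_risingCoeff_real (a : ℝ) {x : ℝ} (h0 : 0 ≤ x) (h1 : x < 1) :
    HasSum (fun k => risingCoeff a k * x ^ k) ((1 - x) ^ (-a)) := by
  have h := hasSum_risingCoeff (a : ℂ) (x := (x : ℂ)) (by simpa [abs_of_nonneg h0] using h1)
  have e : (1 - (x : ℂ)) ^ (-(a : ℂ)) = (((1 - x) ^ (-a) : ℝ) : ℂ) := by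
    rw [Complex.ofReal_cpow (by linarith)]; simp
  rw [e] at h
  have h' := h.mapL Complex.reCLM
  simpa [risingCoeff_ofReal, ← Complex.ofReal_pow] using h'

/-- Euler's limit formula, in terms of the binomial coefficients. -/
lemma tendsto_risingCoeff_mul_cpow {a : ℂ} (ha : ∀ k : ℕ, a ≠ -(k : ℂ)) :
    Tendsto (fun k : ℕ => risingCoeff a k * (k : ℂ) ^ (1 - a)) atTop (𝓝 (Complex.Gamma a)⁻¹) := by
  have hG := (Complex.GammaSeq_tendsto_Gamma a).inv₀ (Complex.Gamma_ne_zero ha)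
  -- `GammaSeq a k` contains the factors $a,\dots,a+k$, one more than `risingCoeff a k`; multiplying
  -- its inverse by $k/(a+k)\to1$ removes the last one and changes $k^{-a}$ into $k^{1-a}$.
  have h1 : Tendsto (fun k : ℕ => (k : ℂ) / (a + k)) atTop (𝓝 1) := by
    simpa [add_comm] using tendsto_natCast_div_add_atTop (𝕜 := ℂ) a
  have h := hG.mul h1
  rw [mul_one] at h
  refine h.congr' ?_
  filter_upwards [eventually_gt_atTop 0] with k hk
  have hk' : (k : ℂ) ≠ 0 := by exact_mod_cast hk.ne'
  have hak : ∀ j : ℕ, a + j ≠ 0 := fun j hj => ha j (eq_neg_of_add_eq_zero_left hj)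
  have hf : ∀ m : ℕ, risingCoeff a m = (∏ j ∈ Finset.range m, (a + j)) / (m.factorial : ℂ) := by
    intro m
    rw [risingCoeff, Finset.prod_div_distrib, ← Finset.prod_range_add_one_eq_factorial]
    push_cast; rfl
  have hfac : (k.factorial : ℂ) ≠ 0 := by exact_mod_cast k.factorial_ne_zero
  have hpk : (k : ℂ) ^ a ≠ 0 := by simp [Complex.cpow_eq_zero_iff, hk']
  rw [hf, Complex.GammaSeq, Finset.prod_range_succ, Complex.cpow_sub _ _ hk', Complex.cpow_one]
  have := hak k
  field_simp

/-! ### Hypergeometric asymptotics and coefficient comparison -/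

/-- A regular summation method maps null sequences to null functions. -/
lemma tendsto_tsum_mul_weight {ι : Type*} {l : Filter ι} {w : ι → ℕ → ℝ}
    (hw : ∀ᶠ i in l, (∀ k, 0 ≤ w i k) ∧ HasSum (w i) 1)
    (hwk : ∀ k, Tendsto (fun i => w i k) l (𝓝 0))
    {η : ℕ → ℝ} (hη0 : ∀ k, 0 ≤ η k) (hη : Tendsto η atTop (𝓝 0)) :
    Tendsto (fun i => ∑' k, η k * w i k) l (𝓝 0) := by
  rw [Metric.tendsto_nhds]
  intro ε hε
  -- Beyond `N` the sequence is below $\varepsilon/2$ and the weights have total mass $1$; the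
  -- finitely many earlier terms vanish in the limit.
  obtain ⟨N, hN⟩ := (eventually_atTop).1 (hη.eventually (gt_mem_nhds (half_pos hε)))
  have hfin : Tendsto (fun i => ∑ k ∈ Finset.range N, η k * w i k) l (𝓝 0) := by
    simpa using tendsto_finsetSum (Finset.range N) fun k _ => (hwk k).const_mul (η k)
  filter_upwards [hw, hfin.eventually (gt_mem_nhds (half_pos hε))] with i ⟨hi0, hi1⟩ hi2
  have hle : ∀ k, η k * w i k ≤ ε / 2 * w i k +
      (if k ∈ Finset.range N then η k * w i k else 0) := by
    intro k
    by_cases hk : k ∈ Finset.range N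
    · simp only [hk, if_true]
      have := mul_nonneg (half_pos hε).le (hi0 k)
      linarith
    · simp only [hk, if_false, add_zero]
      exact mul_le_mul_of_nonneg_right (hN k (by simpa using hk)).le (hi0 k)
  have hs1 : HasSum (fun k => ε / 2 * w i k) (ε / 2) := by simpa using hi1.mul_left (ε / 2)
  have hs2 : HasSum (fun k => if k ∈ Finset.range N then η k * w i k else 0)
      (∑ k ∈ Finset.range N, η k * w i k) := by
    have := hasSum_sum_of_ne_finset_zero (L := SummationFilter.unconditional ℕ)
      (f := fun k => if k ∈ Finset.range N then η k * w i k else 0) (s := Finset.range N)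
      (fun b hb => if_neg hb)
    rwa [Finset.sum_congr rfl (fun k hk => if_pos hk)] at this
  have hs := hs1.add hs2
  have hsum : Summable fun k => η k * w i k :=
    Summable.of_nonneg_of_le (fun k => mul_nonneg (hη0 k) (hi0 k)) hle hs.summable
  have hb := (hsum.tsum_le_tsum hle hs.summable).trans_eq hs.tsum_eq
  have hnn : 0 ≤ ∑' k, η k * w i k := tsum_nonneg fun k => mul_nonneg (hη0 k) (hi0 k)
  rw [Real.dist_eq, sub_zero, abs_of_nonneg hnn]
  linarith

/-- This is the diagonal of the product of two absolutely convergent binomial series, both taken at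
$\sqrt x$. -/
lemma summable_risingCoeff_mul (a b : ℂ) {x : ℝ} (h0 : 0 ≤ x) (h1 : x < 1) :
    Summable fun k => risingCoeff a k * risingCoeff b k * (x : ℂ) ^ k := by
  have hs : ‖((√x : ℝ) : ℂ)‖ < 1 := by
    rw [Complex.norm_real, Real.norm_eq_abs, abs_of_nonneg (Real.sqrt_nonneg x)]
    rw [← Real.sqrt_one]
    exact Real.sqrt_lt_sqrt h0 h1
  have h := (summable_mul_of_summable_norm (summable_norm_risingCoeff a hs)
    (summable_norm_risingCoeff b hs)).comp_injective
    (i := fun k : ℕ => (k, k)) (fun a b h => (Prod.ext_iff.1 h).1)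
  refine h.congr fun k => ?_
  have : (x : ℂ) = ((√x : ℝ) : ℂ) * ((√x : ℝ) : ℂ) := by
    rw [← Complex.ofReal_mul, Real.mul_self_sqrt h0]
  simp only [Function.comp]
  rw [this, mul_pow]; ring

/-- The asymptotics at `1` of the hypergeometric series `F(a, b; 1; x)` for `Re (a + b) > 1`. -/
lemma tendsto_cpow_mul_tsum_risingCoeff {a b : ℂ} (ha : ∀ k : ℕ, a ≠ -(k : ℂ))
    (hb : ∀ k : ℕ, b ≠ -(k : ℂ)) (hab : 1 < a.re + b.re) :
    Tendsto (fun x : ℝ => ((1 - x : ℝ) : ℂ) ^ (a + b - 1) *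
        ∑' k, risingCoeff a k * risingCoeff b k * (x : ℂ) ^ k) (𝓝[<] 1)
      (𝓝 (Complex.Gamma (a + b - 1) / (Complex.Gamma a * Complex.Gamma b))) := by
  set c : ℂ := a + b - 1 with hc
  set σ : ℝ := a.re + b.re - 1 with hσ
  have hσ0 : 0 < σ := by simp only [hσ]; linarith
  have hcre : c.re = σ := by simp [hc, hσ]
  set L : ℂ := Complex.Gamma c / (Complex.Gamma a * Complex.Gamma b) with hL
  have hcne : ∀ k : ℕ, c ≠ -(k : ℂ) := by
    intro k h
    have := congrArg Complex.re h
    simp [hcre] at this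
    have hk : (0 : ℝ) ≤ k := k.cast_nonneg
    linarith
  have hσne : ∀ k : ℕ, (σ : ℂ) ≠ -(k : ℂ) := by
    intro k h
    have := congrArg Complex.re h
    simp at this
    have hk : (0 : ℝ) ≤ k := k.cast_nonneg
    linarith
  -- By Euler's formula and $(1-a)+(1-b)=1-c$, the constant `L` is the one for which the products of
  -- coefficients agree to leading order with `L` times the coefficients of $(1-x)^{-c}$. The error
  -- is measured against `risingCoeff σ`, $\sigma=\Re c$, which is positive and has the same growth.
  set e : ℕ → ℂ := fun k => risingCoeff a k * risingCoeff b k - L * risingCoeff c k with he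
  set η : ℕ → ℝ := fun k => ‖e k‖ / risingCoeff σ k with hη
  have hη0 : ∀ k, 0 ≤ η k := fun k => div_nonneg (norm_nonneg _) (risingCoeff_pos hσ0 k).le
  have hηlim : Tendsto η atTop (𝓝 0) := by
    have hA := (tendsto_risingCoeff_mul_cpow ha).mul (tendsto_risingCoeff_mul_cpow hb)
    have hC := (tendsto_risingCoeff_mul_cpow hcne).const_mul L
    have hS := tendsto_risingCoeff_mul_cpow hσne
    have h := ((hA.sub hC).div hS (inv_ne_zero (Complex.Gamma_ne_zero hσne))).norm
    have hz : (Complex.Gamma a)⁻¹ * (Complex.Gamma b)⁻¹ - L * (Complex.Gamma c)⁻¹ = 0 := by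
      have := Complex.Gamma_ne_zero hcne
      rw [hL]; field_simp; simp
    rw [hz, zero_div, norm_zero] at h
    refine h.congr' ?_
    filter_upwards [eventually_gt_atTop 0] with k hk
    have hk' : (k : ℂ) ≠ 0 := by exact_mod_cast hk.ne'
    have hkr : (0 : ℝ) < k := by exact_mod_cast hk
    have e1 : (k : ℂ) ^ (1 - a) * (k : ℂ) ^ (1 - b) = (k : ℂ) ^ (1 - c) := by
      rw [← Complex.cpow_add _ _ hk', hc]; ring_nf
    have n1 : ‖(k : ℂ) ^ (1 - c)‖ = (k : ℝ) ^ (1 - σ) := by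
      rw [← Complex.ofReal_natCast, Complex.norm_cpow_eq_rpow_re_of_pos hkr]; simp [hcre]
    have n2 : ‖(k : ℂ) ^ (1 - (σ : ℂ))‖ = (k : ℝ) ^ (1 - σ) := by
      rw [← Complex.ofReal_natCast, Complex.norm_cpow_eq_rpow_re_of_pos hkr]; simp
    have e2 : risingCoeff a k * (k : ℂ) ^ (1 - a) * (risingCoeff b k * (k : ℂ) ^ (1 - b)) -
        L * (risingCoeff c k * (k : ℂ) ^ (1 - c)) = e k * (k : ℂ) ^ (1 - c) := by
      rw [he]; simp only; rw [← e1]; ring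
    rw [Pi.div_apply, e2, norm_div, norm_mul, norm_mul, n1, n2, risingCoeff_ofReal, Complex.norm_real,
      Real.norm_eq_abs, abs_of_pos (risingCoeff_pos hσ0 k)]
    have : (k : ℝ) ^ (1 - σ) ≠ 0 := (Real.rpow_pos_of_pos hkr _).ne'
    simp only [hη]
    field_simp
  -- These weights sum to $1$ by the binomial series, and each tends to $0$ as $x\to1$ because
  -- $\sigma>0$.
  set w : ℝ → ℕ → ℝ := fun x k => (1 - x) ^ σ * (risingCoeff σ k * x ^ k) with hw
  have hI : Set.Ioo (0 : ℝ) 1 ∈ 𝓝[<] (1 : ℝ) := Ioo_mem_nhdsLT one_pos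
  have hwsum : ∀ x ∈ Set.Ioo (0 : ℝ) 1, (∀ k, 0 ≤ w x k) ∧ HasSum (w x) 1 := by
    intro x hx
    have h1x : 0 < 1 - x := by linarith [hx.2]
    refine ⟨fun k => ?_, ?_⟩
    · have := (risingCoeff_pos hσ0 k).le
      have := hx.1.le
      simp only [hw]; positivity
    · have := (hasSum_risingCoeff_real σ hx.1.le hx.2).mul_left ((1 - x) ^ σ)
      rwa [← Real.rpow_add h1x, add_neg_cancel, Real.rpow_zero] at this
  have hwk : ∀ k, Tendsto (fun x => w x k) (𝓝[<] 1) (𝓝 0) := by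
    intro k
    have : ContinuousAt (fun x => w x k) 1 := by
      simp only [hw]
      refine ContinuousAt.mul ?_ (by fun_prop)
      exact ContinuousAt.rpow_const (by fun_prop) (Or.inr hσ0.le)
    have h := this.tendsto
    simp only [hw, sub_self, Real.zero_rpow hσ0.ne', zero_mul] at h
    exact h.mono_left nhdsWithin_le_nhds
  have hT := tendsto_tsum_mul_weight (l := 𝓝[<] (1 : ℝ)) (w := w)
    (by filter_upwards [hI] with x hx using hwsum x hx) hwk hη0 hηlim
  rw [tendsto_iff_norm_sub_tendsto_zero]
  refine squeeze_zero' (Eventually.of_forall fun _ => norm_nonneg _) ?_ hT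
  filter_upwards [hI] with x hx
  have h1x : 0 < 1 - x := by linarith [hx.2]
  have h1x' : ((1 - x : ℝ) : ℂ) ≠ 0 := by exact_mod_cast h1x.ne'
  have hxn : ‖(x : ℂ)‖ < 1 := by
    rw [Complex.norm_real, Real.norm_eq_abs, abs_of_pos hx.1]; exact hx.2
  have hC := (hasSum_risingCoeff c hxn).mul_left L
  have hD := (summable_risingCoeff_mul a b hx.1.le hx.2).hasSum
  have hE := (hD.sub hC).mul_left (((1 - x : ℝ) : ℂ) ^ c)
  have hval : ((1 - x : ℝ) : ℂ) ^ c * (1 - (x : ℂ)) ^ (-c) = 1 := by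
    rw [show (1 : ℂ) - x = ((1 - x : ℝ) : ℂ) by push_cast; ring, ← Complex.cpow_add _ _ h1x']
    simp
  have hterm : ∀ k, ‖((1 - x : ℝ) : ℂ) ^ c * (risingCoeff a k * risingCoeff b k * (x : ℂ) ^ k -
      L * (risingCoeff c k * (x : ℂ) ^ k))‖ = η k * w x k := by
    intro k
    have : risingCoeff a k * risingCoeff b k * (x : ℂ) ^ k - L * (risingCoeff c k * (x : ℂ) ^ k)
        = e k * (x : ℂ) ^ k := by rw [he]; ring
    rw [this, norm_mul, norm_mul, Complex.norm_cpow_eq_rpow_re_of_pos h1x, hcre, norm_pow,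
      Complex.norm_real, Real.norm_eq_abs, abs_of_pos hx.1]
    have := (risingCoeff_pos hσ0 k).ne'
    simp only [hη, hw]
    field_simp
  have hle := hE.tsum_eq ▸ norm_tsum_le_tsum_norm hE.summable.norm
  simp_rw [hterm] at hle
  refine le_trans (le_of_eq ?_) hle
  congr 1
  rw [mul_sub, mul_left_comm, hval, mul_one]

/-- The quotient of the two coefficients increases with $k$, since
$(h+k)^2-(k+1)(2h-1+k)=(h-1)^2\ge0$, and Euler's formula identifies its limit as the Gamma quotient.
This is the source of the Gamma factor in `constK`. -/
lemma risingCoeff_sq_le {h : ℝ} (hh : 1 / 2 < h) (k : ℕ) :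
    risingCoeff h k ^ 2 ≤
      Real.Gamma (2 * h - 1) / Real.Gamma h ^ 2 * risingCoeff (2 * h - 1) k := by
  have hσ : 0 < 2 * h - 1 := by linarith
  have hh0 : 0 < h := by linarith
  set q : ℕ → ℝ := fun k => risingCoeff h k ^ 2 / risingCoeff (2 * h - 1) k with hq
  have hmono : Monotone q := by
    refine monotone_nat_of_le_succ fun k => ?_
    have hk : (0 : ℝ) ≤ k := k.cast_nonneg
    have p1 := risingCoeff_pos hσ k
    have p2 := risingCoeff_pos hh0 k
    have : q (k + 1) = q k * ((h + k) ^ 2 / ((k + 1) * (2 * h - 1 + k))) := by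
      simp only [hq, risingCoeff_succ]
      have : 2 * h - 1 + k ≠ 0 := by positivity
      have : risingCoeff (2 * h - 1) k ≠ 0 := p1.ne'
      field_simp
    rw [this]
    have hq0 : 0 ≤ q k := by simp only [hq]; positivity
    refine le_mul_of_one_le_right hq0 ?_
    rw [one_le_div (by positivity)]
    nlinarith [sq_nonneg (h - 1)]
  have hne : ∀ s : ℝ, 0 < s → ∀ k : ℕ, (s : ℂ) ≠ -(k : ℂ) := by
    intro s hs k h
    have := congrArg Complex.re h
    simp at this
    have hk : (0 : ℝ) ≤ k := k.cast_nonneg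
    linarith
  have hlim : Tendsto q atTop (𝓝 (Real.Gamma (2 * h - 1) / Real.Gamma h ^ 2)) := by
    have t := ((tendsto_risingCoeff_mul_cpow (hne h hh0)).pow 2).div
      (tendsto_risingCoeff_mul_cpow (hne _ hσ)) (inv_ne_zero (Complex.Gamma_ne_zero (hne _ hσ)))
    have t' := (Complex.continuous_re.tendsto _).comp t
    have e : ((Complex.Gamma (h : ℂ))⁻¹ ^ 2 / (Complex.Gamma ((2 * h - 1 : ℝ) : ℂ))⁻¹).re =
        Real.Gamma (2 * h - 1) / Real.Gamma h ^ 2 := by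
      rw [Complex.Gamma_ofReal, Complex.Gamma_ofReal, ← Complex.ofReal_inv, ← Complex.ofReal_inv,
        ← Complex.ofReal_pow, ← Complex.ofReal_div, Complex.ofReal_re]
      field_simp
    rw [e] at t'
    refine t'.congr' ?_
    filter_upwards [eventually_gt_atTop 0] with k hk
    have hk' : (k : ℂ) ≠ 0 := by exact_mod_cast hk.ne'
    have e1 : ((k : ℂ) ^ (1 - (h : ℂ))) ^ 2 = (k : ℂ) ^ (1 - ((2 * h - 1 : ℝ) : ℂ)) := by
      rw [pow_two, ← Complex.cpow_add _ _ hk']; push_cast; ring_nf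
    have e2 : (k : ℂ) ^ (1 - ((2 * h - 1 : ℝ) : ℂ)) ≠ 0 := by
      simp [Complex.cpow_eq_zero_iff, hk']
    simp only [Function.comp, Pi.div_apply]
    rw [mul_pow, e1, mul_div_mul_right _ _ e2, risingCoeff_ofReal, risingCoeff_ofReal,
      ← Complex.ofReal_pow, ← Complex.ofReal_div, Complex.ofReal_re]
  have := hmono.ge_of_tendsto hlim k
  simp only [hq] at this
  rwa [div_le_iff₀ (risingCoeff_pos hσ k)] at this

/-! ### Fourier orthogonality on the circle -/

instance isProbabilityMeasure_circleHaar : IsProbabilityMeasure circleHaar :=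
  ⟨by simpa [circleHaar] using Measure.haarMeasure_self (G := Circle) (K₀ := ⊤)⟩

instance isHaarMeasure_circleHaar : circleHaar.IsHaarMeasure := by
  unfold circleHaar; infer_instance

lemma conj_circle_pow_mul_pow_self (ξ : Circle) (k : ℕ) :
    (starRingEnd ℂ) (ξ : ℂ) ^ k * (ξ : ℂ) ^ k = 1 := by
  rw [← mul_pow, ← Complex.normSq_eq_conj_mul_self, Circle.normSq_coe]; simp

lemma integral_conj_pow_mul_pow (i j : ℕ) :
    ∫ ξ : Circle, (starRingEnd ℂ) (ξ : ℂ) ^ i * (ξ : ℂ) ^ j ∂circleHaar =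
      if i = j then 1 else 0 := by
  split_ifs with h
  · subst h
    simp_rw [conj_circle_pow_mul_pow_self]
    simp
  · have hij : (j : ℂ) - i ≠ 0 := sub_ne_zero.2 (by exact_mod_cast Ne.symm h)
    -- Rotation by this `w` multiplies the integrand by $-1$, so invariance of the measure forces
    -- the integral to vanish.
    set w : Circle := Circle.exp (Real.pi / ((j : ℝ) - i)) with hw
    have hwij : (starRingEnd ℂ) (w : ℂ) ^ i * (w : ℂ) ^ j = -1 := by
      rw [hw, Circle.coe_exp, ← Complex.exp_conj, ← Complex.exp_nat_mul, ← Complex.exp_nat_mul,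
        ← Complex.exp_add, ← Complex.exp_pi_mul_I]
      congr 1
      simp only [map_mul, Complex.conj_ofReal, Complex.conj_I]
      push_cast
      field_simp
      ring
    have hinv := integral_mul_left_eq_self (μ := circleHaar)
      (fun ξ : Circle => (starRingEnd ℂ) (ξ : ℂ) ^ i * (ξ : ℂ) ^ j) w
    have e : ∀ ξ : Circle, (starRingEnd ℂ) ((w * ξ : Circle) : ℂ) ^ i * ((w * ξ : Circle) : ℂ) ^ j =
        -1 * ((starRingEnd ℂ) (ξ : ℂ) ^ i * (ξ : ℂ) ^ j) := by
      intro ξ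
      rw [← hwij, Circle.coe_mul, map_mul, mul_pow, mul_pow]; ring
    simp_rw [e] at hinv
    rw [integral_const_mul] at hinv
    linear_combination (-1 / 2 : ℂ) * hinv

lemma integrable_of_continuous_circle {E : Type*} [NormedAddCommGroup E]
    {f : Circle → E} (hf : Continuous f) : Integrable f circleHaar :=
  hf.integrable_of_hasCompactSupport (HasCompactSupport.of_compactSpace f)

/-- Both powers are expanded in binomial series; the double series converges absolutely with bounds
independent of $\xi$, and orthogonality keeps only the diagonal. -/
lemma integral_cpow_mul_cpow (a b : ℂ) {r : ℝ} (h0 : 0 ≤ r) (h1 : r < 1) :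
    ∫ ξ : Circle, (1 - r * (starRingEnd ℂ) (ξ : ℂ)) ^ (-a) * (1 - r * (ξ : ℂ)) ^ (-b) ∂circleHaar =
      ∑' k, risingCoeff a k * risingCoeff b k * ((r ^ 2 : ℝ) : ℂ) ^ k := by
  have hr : ‖(r : ℂ)‖ < 1 := by simpa [abs_of_nonneg h0] using h1
  have hn1 : ∀ ξ : Circle, ‖(r : ℂ) * (starRingEnd ℂ) (ξ : ℂ)‖ < 1 := fun ξ => by simpa [Circle.norm_coe ξ] using hr
  have hn2 : ∀ ξ : Circle, ‖(r : ℂ) * (ξ : ℂ)‖ < 1 := fun ξ => by simpa [Circle.norm_coe ξ] using hr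
  set F : ℕ × ℕ → Circle → ℂ := fun p ξ =>
    (risingCoeff a p.1 * (r * (starRingEnd ℂ) (ξ : ℂ)) ^ p.1) *
      (risingCoeff b p.2 * (r * (ξ : ℂ)) ^ p.2) with hF
  have hFc : ∀ p, Continuous (F p) := fun p => by
    have h1 : Continuous fun ξ : Circle => (ξ : ℂ) := continuous_subtype_val
    have h2 : Continuous fun ξ : Circle => (starRingEnd ℂ) (ξ : ℂ) := Complex.continuous_conj.comp h1
    fun_prop
  have hnorm : ∀ p ξ, ‖F p ξ‖ = ‖risingCoeff a p.1 * (r : ℂ) ^ p.1‖ *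
      ‖risingCoeff b p.2 * (r : ℂ) ^ p.2‖ := by
    intro p ξ; simp [hF, Circle.norm_coe ξ]
  have hsum : Summable fun p => ∫ ξ, ‖F p ξ‖ ∂circleHaar := by
    simp_rw [hnorm]
    simpa using (summable_norm_risingCoeff a hr).mul_of_nonneg (summable_norm_risingCoeff b hr)
      (fun _ => norm_nonneg _) (fun _ => norm_nonneg _)
  have hI := hasSum_integral_of_summable_integral_norm
    (fun p => integrable_of_continuous_circle (hFc p)) hsum
  have hval : ∀ ξ : Circle, ∑' p, F p ξ =
      (1 - r * (starRingEnd ℂ) (ξ : ℂ)) ^ (-a) * (1 - r * (ξ : ℂ)) ^ (-b) := by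
    intro ξ
    rw [← (hasSum_risingCoeff a (hn1 ξ)).tsum_eq, ← (hasSum_risingCoeff b (hn2 ξ)).tsum_eq]
    exact (tsum_mul_tsum_of_summable_norm (summable_norm_risingCoeff a (hn1 ξ))
      (summable_norm_risingCoeff b (hn2 ξ))).symm
  simp_rw [hval] at hI
  have hterm : ∀ p : ℕ × ℕ, ∫ ξ, F p ξ ∂circleHaar =
      if p.1 = p.2 then risingCoeff a p.1 * risingCoeff b p.2 * (r : ℂ) ^ (p.1 + p.2) else 0 := by
    intro p
    have : ∀ ξ, F p ξ = risingCoeff a p.1 * risingCoeff b p.2 * (r : ℂ) ^ (p.1 + p.2) *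
        ((starRingEnd ℂ) (ξ : ℂ) ^ p.1 * (ξ : ℂ) ^ p.2) := by
      intro ξ; simp only [hF, mul_pow, pow_add]; ring
    simp_rw [this]
    rw [integral_const_mul, integral_conj_pow_mul_pow]
    simp
  simp_rw [hterm] at hI
  have hinj : Function.Injective fun k : ℕ => (k, k) := fun a b h => (Prod.ext_iff.1 h).1
  rw [← hinj.hasSum_iff] at hI
  · rw [← hI.tsum_eq]
    refine tsum_congr fun k => ?_
    simp only [Function.comp, if_true]
    push_cast
    rw [← two_mul, pow_mul]
  · rintro ⟨i, j⟩ hp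
    refine if_neg fun h => hp ⟨i, ?_⟩
    simp only at h
    simp [h]

/-! ### The one-variable kernel: mass, $L^1$ bound, concentration -/

/-- The one-variable `(a, b)`-Poisson kernel. -/
def kernel (a b z ξ : ℂ) : ℂ :=
  coef a b * (((1 - ‖z‖ ^ 2 : ℝ) : ℂ) ^ (a + b + 1) /
    ((1 - z * (starRingEnd ℂ) ξ) ^ (a + 1) * (1 - (starRingEnd ℂ) z * ξ) ^ (b + 1)))

lemma poissonKernel_eq_prod {n : ℕ} (α β : Fin n → ℂ) (z : Fin n → ℂ) (ζ : Torus n) :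
    poissonKernel α β z ζ = ∏ j, kernel (α j) (β j) (z j) (ζ j) := rfl

lemma one_sub_re_pos {z : ℂ} (hz : ‖z‖ < 1) : 0 < (1 - z).re := by
  have := Complex.re_le_norm z
  simp; linarith

lemma integral_kernel (a b : ℂ) {r : ℝ} (h0 : 0 ≤ r) (h1 : r < 1) :
    ∫ ξ : Circle, kernel a b r ξ ∂circleHaar =
      coef a b * (((1 - r ^ 2 : ℝ) : ℂ) ^ (a + b + 1) *
        ∑' k, risingCoeff (a + 1) k * risingCoeff (b + 1) k * ((r ^ 2 : ℝ) : ℂ) ^ k) := by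
  rw [← integral_cpow_mul_cpow _ _ h0 h1, ← integral_const_mul, ← integral_const_mul]
  congr 1 with ξ
  simp only [kernel, Complex.conj_ofReal, Complex.norm_real, Real.norm_eq_abs, sq_abs,
    Complex.cpow_neg]
  rw [← mul_inv, div_eq_mul_inv]

/-- The normalisation `coef a b` is exactly the inverse of the Gamma quotient in the hypergeometric
asymptotics. -/
lemma tendsto_integral_kernel {a b : ℂ} (hab : -1 < a.re + b.re)
    (ha : ∀ k : ℕ, a ≠ -((k : ℂ) + 1)) (hb : ∀ k : ℕ, b ≠ -((k : ℂ) + 1)) :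
    Tendsto (fun r : ℝ => ∫ ξ : Circle, kernel a b r ξ ∂circleHaar) (𝓝[Set.Ico 0 1] 1) (𝓝 1) := by
  have ha' : ∀ k : ℕ, a + 1 ≠ -(k : ℂ) := fun k h => ha k (by linear_combination h)
  have hb' : ∀ k : ℕ, b + 1 ≠ -(k : ℂ) := fun k h => hb k (by linear_combination h)
  have hc' : ∀ k : ℕ, a + b + 1 ≠ -(k : ℂ) := by
    intro k h
    have := congrArg Complex.re h
    simp at this
    have hk : (0 : ℝ) ≤ k := k.cast_nonneg
    linarith
  have hT := tendsto_cpow_mul_tsum_risingCoeff ha' hb' (by simp; linarith)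
  have hsq : Tendsto (fun r : ℝ => r ^ 2) (𝓝[Set.Ico 0 1] 1) (𝓝[<] 1) := by
    refine tendsto_nhdsWithin_iff.2 ⟨?_, ?_⟩
    · have : ContinuousAt (fun r : ℝ => r ^ 2) 1 := by fun_prop
      simpa using this.tendsto.mono_left nhdsWithin_le_nhds
    · filter_upwards [self_mem_nhdsWithin] with r hr
      exact pow_lt_one₀ hr.1 hr.2 two_ne_zero
  have h := (hT.comp hsq).const_mul (coef a b)
  have e : coef a b * (Complex.Gamma (a + 1 + (b + 1) - 1) /
      (Complex.Gamma (a + 1) * Complex.Gamma (b + 1))) = 1 := by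
    have h1 := Complex.Gamma_ne_zero ha'
    have h2 := Complex.Gamma_ne_zero hb'
    have h3 := Complex.Gamma_ne_zero hc'
    rw [coef, show a + 1 + (b + 1) - 1 = a + b + 1 by ring]
    field_simp
  rw [e] at h
  refine h.congr' ?_
  filter_upwards [self_mem_nhdsWithin] with r hr
  rw [integral_kernel a b hr.1 hr.2]
  simp only [Function.comp]
  rw [show a + 1 + (b + 1) - 1 = a + b + 1 by ring]

/-- The two bases are conjugate, so their arguments are opposite and the imaginary parts of the
exponents contribute only $e^{\arg w\,(\Im a-\Im b)}$. Since $\Re w>0$, $|\arg w|\le\pi/2$. -/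
lemma norm_kernel_le (a b : ℂ) {z ξ : ℂ} (hz : ‖z‖ < 1) (hξ : ‖ξ‖ = 1) :
    ‖kernel a b z ξ‖ ≤ ‖coef a b‖ * Real.exp (Real.pi / 2 * |a.im - b.im|) *
      ((1 - ‖z‖ ^ 2) ^ (a.re + b.re + 1) *
        ‖1 - z * (starRingEnd ℂ) ξ‖ ^ (-(a.re + b.re + 2))) := by
  set w : ℂ := 1 - z * (starRingEnd ℂ) ξ with hw
  have hre : 0 < w.re := one_sub_re_pos (by simpa [hξ] using hz)
  have hw0 : w ≠ 0 := fun h => by simp [h] at hre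
  have hwc : 1 - (starRingEnd ℂ) z * ξ = (starRingEnd ℂ) w := by simp [hw]
  have hwc0 : (starRingEnd ℂ) w ≠ 0 := by simpa using hw0
  have harg : |w.arg| ≤ Real.pi / 2 := Complex.abs_arg_le_pi_div_two_iff.2 hre.le
  have hargc : ((starRingEnd ℂ) w).arg = -w.arg := by
    rw [Complex.arg_conj, if_neg]
    intro h
    rw [h, abs_of_pos Real.pi_pos] at harg
    linarith [Real.pi_pos]
  have hpos : 0 < 1 - ‖z‖ ^ 2 := by
    have := pow_lt_one₀ (norm_nonneg z) hz two_ne_zero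
    linarith
  have hnw : 0 < ‖w‖ := norm_pos_iff.2 hw0
  have hden : ‖w ^ (a + 1) * (starRingEnd ℂ) w ^ (b + 1)‖ =
      ‖w‖ ^ (a.re + b.re + 2) * Real.exp (-(w.arg * (a.im - b.im))) := by
    rw [norm_mul, Complex.norm_cpow_of_ne_zero hw0, Complex.norm_cpow_of_ne_zero hwc0, hargc,
      Complex.norm_conj, div_mul_div_comm, ← Real.rpow_add hnw, ← Real.exp_add, Real.exp_neg,
      div_eq_mul_inv]
    simp only [Complex.add_re, Complex.add_im, Complex.one_re, Complex.one_im]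
    congr 2
    · ring
    · congr 1; ring
  rw [kernel, hwc, norm_mul, norm_div, hden, Complex.norm_cpow_eq_rpow_re_of_pos hpos,
    Real.rpow_neg hnw.le, mul_assoc]
  refine mul_le_mul_of_nonneg_left ?_ (norm_nonneg _)
  have hexp : Real.exp (w.arg * (a.im - b.im)) ≤ Real.exp (Real.pi / 2 * |a.im - b.im|) := by
    refine Real.exp_le_exp.2 ((le_abs_self _).trans ?_)
    rw [abs_mul]
    exact mul_le_mul_of_nonneg_right harg (abs_nonneg _)
  have e : (1 - ‖z‖ ^ 2) ^ (a + b + 1).re / (‖w‖ ^ (a.re + b.re + 2) *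
      Real.exp (-(w.arg * (a.im - b.im)))) = Real.exp (w.arg * (a.im - b.im)) *
      ((1 - ‖z‖ ^ 2) ^ (a.re + b.re + 1) * (‖w‖ ^ (a.re + b.re + 2))⁻¹) := by
    rw [Real.exp_neg]
    simp only [Complex.add_re, Complex.one_re]
    field_simp
  rw [e]
  exact mul_le_mul_of_nonneg_right hexp (by positivity)

lemma continuous_kernel (a b : ℂ) {z : ℂ} (hz : ‖z‖ < 1) :
    Continuous fun ξ : Circle => kernel a b z ξ := by
  have h1 : Continuous fun ξ : Circle => (ξ : ℂ) := continuous_subtype_val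
  have h2 : Continuous fun ξ : Circle => (starRingEnd ℂ) (ξ : ℂ) := Complex.continuous_conj.comp h1
  have s1 : ∀ ξ : Circle, 1 - z * (starRingEnd ℂ) (ξ : ℂ) ∈ Complex.slitPlane := fun ξ =>
    Or.inl (one_sub_re_pos (by simpa [Circle.norm_coe ξ] using hz))
  have s2 : ∀ ξ : Circle, 1 - (starRingEnd ℂ) z * (ξ : ℂ) ∈ Complex.slitPlane := fun ξ =>
    Or.inl (one_sub_re_pos (by simpa [Circle.norm_coe ξ] using hz))
  unfold kernel
  refine continuous_const.mul (continuous_const.div ?_ ?_)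
  · exact ((by fun_prop : Continuous fun ξ : Circle => 1 - z * (starRingEnd ℂ) (ξ : ℂ)).cpow
      continuous_const s1).mul ((by fun_prop :
        Continuous fun ξ : Circle => 1 - (starRingEnd ℂ) z * (ξ : ℂ)).cpow continuous_const s2)
  · intro ξ
    refine mul_ne_zero ?_ ?_ <;> rw [Ne, Complex.cpow_eq_zero_iff] <;> rintro ⟨h, -⟩
    · exact Complex.slitPlane_ne_zero (s1 ξ) h
    · exact Complex.slitPlane_ne_zero (s2 ξ) h

/-- With $h=s/2+1$ the integrand is $w^{-h}\bar w^{-h}$, so the integral is a series with squared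
coefficients. The termwise majorant sums to a multiple of $(1-r^2)^{-(s+1)}$, which the prefactor
cancels. -/
lemma integral_norm_rpow_le {s : ℝ} (hs : -1 < s) {r : ℝ} (h0 : 0 ≤ r) (h1 : r < 1) :
    ∫ ξ : Circle, (1 - r ^ 2) ^ (s + 1) *
        ‖1 - (r : ℂ) * (starRingEnd ℂ) (ξ : ℂ)‖ ^ (-(s + 2)) ∂circleHaar ≤
      Real.Gamma (s + 1) / Real.Gamma (s / 2 + 1) ^ 2 := by
  set h : ℝ := s / 2 + 1 with hh
  have hh' : 1 / 2 < h := by simp only [hh]; linarith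
  have h2 : 2 * h - 1 = s + 1 := by simp only [hh]; ring
  have hr2 : r ^ 2 < 1 := pow_lt_one₀ h0 h1 two_ne_zero
  have hpos : 0 < 1 - r ^ 2 := by linarith
  have hS := hasSum_risingCoeff_real (2 * h - 1) (sq_nonneg r) hr2
  have hI : ∀ ξ : Circle,
      ((‖1 - (r : ℂ) * (starRingEnd ℂ) (ξ : ℂ)‖ ^ (-(s + 2)) : ℝ) : ℂ) =
      (1 - r * (starRingEnd ℂ) (ξ : ℂ)) ^ (-(h : ℂ)) * (1 - r * (ξ : ℂ)) ^ (-(h : ℂ)) := by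
    intro ξ
    set w : ℂ := 1 - r * (starRingEnd ℂ) (ξ : ℂ) with hw
    have hre : 0 < w.re := one_sub_re_pos (by simpa [abs_of_nonneg h0, Circle.norm_coe ξ] using h1)
    have hw0 : w ≠ 0 := fun h => by simp [h] at hre
    have hc : 1 - r * (ξ : ℂ) = (starRingEnd ℂ) w := by simp [hw]
    have harg : w.arg ≠ Real.pi := by
      intro h'
      have := Complex.abs_arg_le_pi_div_two_iff.2 hre.le
      rw [h', abs_of_pos Real.pi_pos] at this
      linarith [Real.pi_pos]
    rw [hc, Complex.conj_cpow _ _ harg]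
    have : (starRingEnd ℂ) (-(h : ℂ)) = -(h : ℂ) := by simp
    rw [this, Complex.mul_conj, Complex.normSq_eq_norm_sq, Complex.norm_cpow_of_ne_zero hw0]
    congr 1
    simp only [Complex.neg_re, Complex.neg_im, Complex.ofReal_re, Complex.ofReal_im]
    rw [neg_zero, mul_zero, Real.exp_zero, div_one, ← Real.rpow_natCast, ← Real.rpow_mul
      (norm_nonneg _)]
    congr 1
    simp only [hh]; push_cast; ring
  have hint : ∫ ξ : Circle, ‖1 - (r : ℂ) * (starRingEnd ℂ) (ξ : ℂ)‖ ^ (-(s + 2)) ∂circleHaar =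
      ∑' k, risingCoeff h k ^ 2 * (r ^ 2) ^ k := by
    have := integral_cpow_mul_cpow (h : ℂ) (h : ℂ) h0 h1
    simp_rw [← hI] at this
    apply Complex.ofReal_injective
    refine ((integral_ofReal (𝕜 := ℂ)).symm.trans this).trans ?_
    rw [Complex.ofReal_tsum]
    refine tsum_congr fun k => ?_
    rw [risingCoeff_ofReal]; push_cast; ring
  have hle : ∀ k, risingCoeff h k ^ 2 * (r ^ 2) ^ k ≤
      Real.Gamma (2 * h - 1) / Real.Gamma h ^ 2 * (risingCoeff (2 * h - 1) k * (r ^ 2) ^ k) := by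
    intro k
    rw [← mul_assoc]
    exact mul_le_mul_of_nonneg_right (risingCoeff_sq_le hh' k) (by positivity)
  have hS' := hS.mul_left (Real.Gamma (2 * h - 1) / Real.Gamma h ^ 2)
  have hb := ((Summable.of_nonneg_of_le (fun k => by positivity) hle hS'.summable).tsum_le_tsum hle
    hS'.summable).trans_eq hS'.tsum_eq
  rw [integral_const_mul, hint]
  refine (mul_le_mul_of_nonneg_left hb (by positivity)).trans_eq ?_
  rw [h2, mul_left_comm, ← Real.rpow_add hpos]
  simp

/-- The one-variable factor of `constK`. -/
def kernelBound (a b : ℂ) : ℝ :=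
  ‖coef a b‖ * Real.exp (Real.pi / 2 * |a.im - b.im|) *
    (Real.Gamma (a.re + b.re + 1) / Real.Gamma ((a.re + b.re) / 2 + 1) ^ 2)

lemma norm_one_sub_pos {z : ℂ} (hz : ‖z‖ < 1) : 0 < ‖1 - z‖ :=
  norm_pos_iff.2 fun h => by have := one_sub_re_pos hz; simp [h] at this

lemma integral_norm_kernel_le {a b : ℂ} (hab : -1 < a.re + b.re) {r : ℝ} (h0 : 0 ≤ r)
    (h1 : r < 1) : ∫ ξ : Circle, ‖kernel a b r ξ‖ ∂circleHaar ≤ kernelBound a b := by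
  have hr : ‖(r : ℂ)‖ < 1 := by simpa [abs_of_nonneg h0] using h1
  have hcont : Continuous fun ξ : Circle => (1 - r ^ 2) ^ (a.re + b.re + 1) *
      ‖1 - (r : ℂ) * (starRingEnd ℂ) (ξ : ℂ)‖ ^ (-(a.re + b.re + 2)) := by
    have h1 : Continuous fun ξ : Circle => (ξ : ℂ) := continuous_subtype_val
    have h2 : Continuous fun ξ : Circle => (starRingEnd ℂ) (ξ : ℂ) := Complex.continuous_conj.comp h1
    refine continuous_const.mul (Continuous.rpow_const (by fun_prop) fun ξ => Or.inl ?_)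
    exact (norm_one_sub_pos (by simpa [Circle.norm_coe ξ] using hr)).ne'
  calc ∫ ξ : Circle, ‖kernel a b r ξ‖ ∂circleHaar
      ≤ ∫ ξ : Circle, ‖coef a b‖ * Real.exp (Real.pi / 2 * |a.im - b.im|) *
        ((1 - r ^ 2) ^ (a.re + b.re + 1) *
        ‖1 - (r : ℂ) * (starRingEnd ℂ) (ξ : ℂ)‖ ^ (-(a.re + b.re + 2))) ∂circleHaar := by
        refine integral_mono (integrable_of_continuous_circle (continuous_kernel a b hr).norm)
          (integrable_of_continuous_circle (hcont.const_mul _)) fun ξ => ?_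
        simpa [sq_abs] using norm_kernel_le a b hr (Circle.norm_coe ξ)
    _ ≤ kernelBound a b := by
        rw [integral_const_mul]
        exact mul_le_mul_of_nonneg_left (integral_norm_rpow_le hab h0 h1) (by positivity)

/-- On this set $\delta\le|\xi-1|\le(1-r)+|1-r\bar\xi|\le2|1-r\bar\xi|$, so the kernel is uniformly
$O((1-r^2)^{s+1})$, with positive exponent. -/
lemma tendsto_integral_indicator_kernel {a b : ℂ} (hab : -1 < a.re + b.re) {δ : ℝ} (hδ : 0 < δ) :
    Tendsto (fun r : ℝ => ∫ ξ : Circle, {ξ : Circle | δ ≤ ‖(ξ : ℂ) - 1‖}.indicator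
      (fun ξ : Circle => ‖kernel a b r ξ‖) ξ ∂circleHaar) (𝓝[Set.Ico 0 1] 1) (𝓝 0) := by
  set A : ℝ := ‖coef a b‖ * Real.exp (Real.pi / 2 * |a.im - b.im|) with hA
  have hT : Tendsto (fun r : ℝ => A * ((1 - r ^ 2) ^ (a.re + b.re + 1) *
      (δ / 2) ^ (-(a.re + b.re + 2)))) (𝓝[Set.Ico 0 1] 1) (𝓝 0) := by
    have hc : ContinuousAt (fun r : ℝ => A * ((1 - r ^ 2) ^ (a.re + b.re + 1) *
        (δ / 2) ^ (-(a.re + b.re + 2)))) 1 := by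
      refine continuousAt_const.mul (ContinuousAt.mul ?_ continuousAt_const)
      exact ContinuousAt.rpow_const (by fun_prop) (Or.inr (by linarith))
    have := hc.tendsto
    simp only [one_pow, sub_self] at this
    rw [Real.zero_rpow (by linarith), zero_mul, mul_zero] at this
    exact this.mono_left nhdsWithin_le_nhds
  refine squeeze_zero' (Eventually.of_forall fun r => integral_nonneg fun ξ =>
    Set.indicator_nonneg (fun _ _ => norm_nonneg _) _) ?_ hT
  filter_upwards [self_mem_nhdsWithin] with r hr
  have hrn : ‖(r : ℂ)‖ = r := by simp [abs_of_nonneg hr.1]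
  have hr1 : ‖(r : ℂ)‖ < 1 := hrn.trans_lt hr.2
  have hpos : 0 < 1 - r ^ 2 := by
    have := pow_lt_one₀ hr.1 hr.2 two_ne_zero
    linarith
  have hb : ∀ ξ : Circle, {ξ : Circle | δ ≤ ‖(ξ : ℂ) - 1‖}.indicator
      (fun ξ : Circle => ‖kernel a b r ξ‖) ξ ≤
      A * ((1 - r ^ 2) ^ (a.re + b.re + 1) * (δ / 2) ^ (-(a.re + b.re + 2))) := by
    intro ξ
    refine Set.indicator_apply_le' (fun hξ => ?_) fun _ => by positivity
    refine (norm_kernel_le a b hr1 (Circle.norm_coe ξ)).trans ?_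
    rw [hrn]
    refine mul_le_mul_of_nonneg_left (mul_le_mul_of_nonneg_left ?_ (by positivity)) (by positivity)
    refine Real.rpow_le_rpow_of_nonpos (by positivity) ?_ (by linarith)
    have hξ' : δ ≤ ‖(ξ : ℂ) - 1‖ := hξ
    have e1 : ‖(ξ : ℂ) - 1‖ = ‖(starRingEnd ℂ) (ξ : ℂ) - 1‖ := by
      rw [← Complex.norm_conj]; simp
    have e2 : (starRingEnd ℂ) (ξ : ℂ) - 1 =
        ((1 - r : ℝ) : ℂ) * (starRingEnd ℂ) (ξ : ℂ) - (1 - r * (starRingEnd ℂ) (ξ : ℂ)) := by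
      push_cast; ring
    have e3 : ‖((1 - r : ℝ) : ℂ) * (starRingEnd ℂ) (ξ : ℂ)‖ = 1 - r := by
      rw [norm_mul, Complex.norm_conj, Circle.norm_coe, Complex.norm_real, mul_one,
        Real.norm_eq_abs, abs_of_pos (by linarith [hr.2])]
    have e4 : 1 - r ≤ ‖1 - r * (starRingEnd ℂ) (ξ : ℂ)‖ := by
      have := norm_sub_norm_le (1 : ℂ) (r * (starRingEnd ℂ) (ξ : ℂ))
      simpa [abs_of_nonneg hr.1, Circle.norm_coe ξ] using this
    have := norm_sub_le (((1 - r : ℝ) : ℂ) * (starRingEnd ℂ) (ξ : ℂ))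
      (1 - r * (starRingEnd ℂ) (ξ : ℂ))
    rw [← e2, e3, ← e1] at this
    linarith
  have hms : MeasurableSet {ξ : Circle | δ ≤ ‖(ξ : ℂ) - 1‖} :=
    (isClosed_le continuous_const
      (by have h1 : Continuous fun ξ : Circle => (ξ : ℂ) := continuous_subtype_val
          fun_prop)).measurableSet
  refine (integral_mono ((integrable_of_continuous_circle
    (continuous_kernel a b hr1).norm).indicator hms) (integrable_const _) hb).trans_eq ?_
  simp

/-! ### Differentiation under the integral sign -/

section ContinuousIntegrand

variable {E W X V : Type*} [TopologicalSpace E] [TopologicalSpace W]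
  [TopologicalSpace X] [CompactSpace X] {ι : X → W} {Ω : Set (E × W)}

/-- By compactness of `X` (tube lemma) one neighbourhood of `z` and one bound serve all parameters;
this supplies every dominating function below. -/
lemma eventually_forall_norm_le [NormedAddCommGroup V] {F : E × W → V} (hΩ : IsOpen Ω)
    (hF : ContinuousOn F Ω) (hι : Continuous ι) {z : E} (hz : ∀ x, (z, ι x) ∈ Ω) :
    ∃ C, ∀ᶠ y in 𝓝 z, ∀ x, (y, ι x) ∈ Ω ∧ ‖F (y, ι x)‖ ≤ C := by
  have hc : Continuous fun x => F (z, ι x) :=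
    hF.comp_continuous (by fun_prop) hz
  obtain ⟨C, hC⟩ := (isCompact_univ.image hc.norm).isBounded.exists_norm_le
  refine ⟨C + 1, ?_⟩
  have := (isCompact_univ (X := X)).eventually_forall_of_forall_eventually (x₀ := z)
    (P := fun y x => (y, ι x) ∈ Ω ∧ ‖F (y, ι x)‖ ≤ C + 1) fun x _ => by
      have hp : Continuous fun q : E × X => (q.1, ι q.2) := by fun_prop
      have h1 := hp.continuousAt (x := (z, x)) (hΩ.mem_nhds (hz x))
      have h2 : ContinuousAt (fun q : E × X => ‖F (q.1, ι q.2)‖) (z, x) :=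
        (ContinuousAt.comp' (f := fun q : E × X => (q.1, ι q.2))
          (hF.continuousAt (hΩ.mem_nhds (hz x))) hp.continuousAt).norm
      have h3 : ‖F (z, ι x)‖ < C + 1 := by
        have := hC _ ⟨x, trivial, rfl⟩
        rw [norm_norm] at this
        linarith
      filter_upwards [h1, h2.eventually (gt_mem_nhds h3)] with q hq1 hq2 using ⟨hq1, hq2.le⟩
  filter_upwards [this] with y hy x using hy x trivial

lemma integrable_smul_of_continuousOn [SecondCountableTopology X] [MeasurableSpace X]
    [BorelSpace X] {μ : Measure X} {ψ : X → ℂ} [NormedAddCommGroup V] [NormedSpace ℂ V]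
    {F : E × W → V} (hF : ContinuousOn F Ω)
    (hι : Continuous ι) (hψ : Integrable ψ μ) {z : E} (hz : ∀ x, (z, ι x) ∈ Ω) :
    Integrable (fun x => ψ x • F (z, ι x)) μ := by
  have hc : Continuous fun x => F (z, ι x) := hF.comp_continuous (by fun_prop) hz
  obtain ⟨C, hC⟩ := (isCompact_univ.image hc.norm).isBounded.exists_norm_le
  refine (hψ.norm.mul_const C).mono' (hψ.aestronglyMeasurable.smul hc.aestronglyMeasurable)
    (Eventually.of_forall fun x => ?_)
  rw [norm_smul]
  have := hC _ ⟨x, trivial, rfl⟩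
  rw [norm_norm] at this
  exact mul_le_mul_of_nonneg_left this (norm_nonneg _)

end ContinuousIntegrand

section ParametricIntegral

variable {E W X V : Type} [NormedAddCommGroup E] [NormedSpace ℝ E]
  [NormedAddCommGroup W] [NormedSpace ℝ W]
  [TopologicalSpace X] [CompactSpace X] [SecondCountableTopology X] [MeasurableSpace X]
  [BorelSpace X] {μ : Measure X} {ψ : X → ℂ} {ι : X → W} {Ω : Set (E × W)} {U : Set E}

lemma hasFDerivAt_integral_smul [NormedAddCommGroup V] [NormedSpace ℝ V] [NormedSpace ℂ V]
    [IsScalarTower ℝ ℂ V] {F : E × W → V} (hΩ : IsOpen Ω)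
    (hF : ContDiffOn ℝ 1 F Ω) (hι : Continuous ι) (hψ : Integrable ψ μ) {z : E}
    (hz : ∀ x, (z, ι x) ∈ Ω) :
    HasFDerivAt (fun y => ∫ x, ψ x • F (y, ι x) ∂μ)
      (∫ x, ψ x • (fderiv ℝ F (z, ι x)).comp (ContinuousLinearMap.inl ℝ E W) ∂μ) z := by
  have hF' : ContinuousOn (fun q => (fderiv ℝ F q).comp (ContinuousLinearMap.inl ℝ E W)) Ω :=
    (hF.continuousOn_fderiv_of_isOpen hΩ le_rfl).clm_comp continuousOn_const
  obtain ⟨C, hC⟩ := eventually_forall_norm_le hΩ hF' hι hz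
  refine hasFDerivAt_integral_of_dominated_of_fderiv_le
    (F' := fun y x => ψ x • (fderiv ℝ F (y, ι x)).comp (ContinuousLinearMap.inl ℝ E W))
    (bound := fun x => ‖ψ x‖ * C) hC ?_ ?_ ?_ ?_ (hψ.norm.mul_const C) ?_
  · filter_upwards [hC] with y hy
    exact (integrable_smul_of_continuousOn hF.continuousOn hι hψ
      fun x => (hy x).1).aestronglyMeasurable
  · exact integrable_smul_of_continuousOn hF.continuousOn hι hψ hz
  · exact (integrable_smul_of_continuousOn hF' hι hψ hz).aestronglyMeasurable
  · refine Eventually.of_forall fun x y hy => ?_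
    rw [norm_smul]
    exact mul_le_mul_of_nonneg_left (hy x).2 (norm_nonneg _)
  · refine Eventually.of_forall fun x y hy => ?_
    have h1 := ((hF.differentiableOn one_ne_zero).differentiableAt
      (hΩ.mem_nhds (hy x).1)).hasFDerivAt
    exact (h1.comp y (hasFDerivAt_prodMk_left y (ι x))).const_smul (ψ x)

/-- The induction quantifies over `V` because the derivative of the integrand takes values in `E
→L[ℝ] V`; keeping all types in `Type` lets the induction hypothesis apply to that space. -/
lemma contDiffOn_integral_smul (n : ℕ) : ∀ {V : Type} [NormedAddCommGroup V] [NormedSpace ℝ V]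
    [NormedSpace ℂ V] [IsScalarTower ℝ ℂ V] {F : E × W → V} (_ : IsOpen Ω) (_ : IsOpen U)
    (_ : ContDiffOn ℝ n F Ω) (_ : Continuous ι) (_ : Integrable ψ μ)
    (_ : ∀ z ∈ U, ∀ x, (z, ι x) ∈ Ω),
    ContDiffOn ℝ n (fun y => ∫ x, ψ x • F (y, ι x) ∂μ) U := by
  induction n with
  | zero =>
    intro V _ _ _ _ F hΩ hU hF hι hψ hz
    simp only [Nat.cast_zero, contDiffOn_zero] at hF ⊢
    intro z hzU
    obtain ⟨C, hC⟩ := eventually_forall_norm_le hΩ hF hι (hz z hzU)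
    refine (continuousAt_of_dominated (bound := fun x => ‖ψ x‖ * C) ?_ ?_ (hψ.norm.mul_const C)
      ?_).continuousWithinAt
    · filter_upwards [hC] with y hy
      exact (integrable_smul_of_continuousOn hF hι hψ fun x => (hy x).1).aestronglyMeasurable
    · filter_upwards [hC] with y hy
      refine Eventually.of_forall fun x => ?_
      rw [norm_smul]
      exact mul_le_mul_of_nonneg_left (hy x).2 (norm_nonneg _)
    · refine Eventually.of_forall fun x => ?_
      have h1 := hF.continuousAt (hΩ.mem_nhds (hz z hzU x))
      exact (h1.comp' (f := fun y => (y, ι x)) (by fun_prop)).const_smul _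
  | succ n ih =>
    intro V _ _ _ _ F hΩ hU hF hι hψ hz
    have hF1 : ContDiffOn ℝ 1 F Ω := hF.of_le (by exact_mod_cast Nat.le_add_left 1 n)
    have hder := fun z hzU => hasFDerivAt_integral_smul hΩ hF1 hι hψ (hz z hzU)
    push_cast at hF ⊢
    rw [contDiffOn_succ_iff_fderiv_of_isOpen hΩ] at hF
    rw [contDiffOn_succ_iff_fderiv_of_isOpen hU]
    refine ⟨fun z hzU => (hder z hzU).differentiableAt.differentiableWithinAt,
      fun h => absurd h (WithTop.natCast_ne_top n), ?_⟩
    have h2 := ih (F := fun q => (fderiv ℝ F q).comp (ContinuousLinearMap.inl ℝ E W)) hΩ hU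
      (hF.2.2.clm_comp contDiffOn_const) hι hψ hz
    exact h2.congr fun z hzU => (hder z hzU).fderiv

lemma lineDeriv_eq_fderiv_inl [NormedAddCommGroup V] [NormedSpace ℝ V] {F : E × W → V}
    (hΩ : IsOpen Ω) (hF : ContDiffOn ℝ 1 F Ω) (v : E) {q : E × W} (hq : q ∈ Ω) :
    lineDeriv ℝ (fun y => F (y, q.2)) q.1 v = fderiv ℝ F q (v, 0) := by
  have h1 := ((hF.differentiableOn one_ne_zero).differentiableAt (hΩ.mem_nhds hq)).hasFDerivAt
  have h2 := h1.comp q.1 (f := fun y => (y, q.2)) (hasFDerivAt_prodMk_left q.1 q.2)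
  have := (h2.hasLineDerivAt v).lineDeriv
  simpa [Function.comp_def] using this

/-- Smoothness is needed jointly with the parameter, so that a differentiated integrand can be
differentiated under the integral again. -/
lemma contDiffOn_lineDeriv [NormedAddCommGroup V] [NormedSpace ℝ V] {F : E × W → V} {n : ℕ}
    (hΩ : IsOpen Ω) (hF : ContDiffOn ℝ (n + 1) F Ω) (v : E) :
    ContDiffOn ℝ n (fun q : E × W => lineDeriv ℝ (fun y => F (y, q.2)) q.1 v) Ω := by
  have hF1 : ContDiffOn ℝ 1 F Ω := hF.of_le (by exact_mod_cast Nat.le_add_left 1 n)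
  have h := ((contDiffOn_succ_iff_fderiv_of_isOpen hΩ).1 hF).2.2.clm_apply
    (contDiffOn_const (c := ((v, 0) : E × W)))
  exact h.congr fun q hq => lineDeriv_eq_fderiv_inl hΩ hF1 v hq

lemma lineDeriv_integral_smul [NormedAddCommGroup V] [NormedSpace ℝ V] [NormedSpace ℂ V]
    [IsScalarTower ℝ ℂ V] [CompleteSpace V] {F : E × W → V} (hΩ : IsOpen Ω)
    (hF : ContDiffOn ℝ 1 F Ω) (hι : Continuous ι) (hψ : Integrable ψ μ) {z : E}
    (hz : ∀ x, (z, ι x) ∈ Ω) (v : E) :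
    lineDeriv ℝ (fun y => ∫ x, ψ x • F (y, ι x) ∂μ) z v =
      ∫ x, ψ x • lineDeriv ℝ (fun y => F (y, ι x)) z v ∂μ := by
  have hF' : ContinuousOn (fun q => (fderiv ℝ F q).comp (ContinuousLinearMap.inl ℝ E W)) Ω :=
    (hF.continuousOn_fderiv_of_isOpen hΩ le_rfl).clm_comp continuousOn_const
  rw [((hasFDerivAt_integral_smul hΩ hF hι hψ hz).hasLineDerivAt v).lineDeriv,
    ContinuousLinearMap.integral_apply (integrable_smul_of_continuousOn hF' hι hψ hz)]
  refine integral_congr_ae (Eventually.of_forall fun x => ?_)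
  simp only
  rw [lineDeriv_eq_fderiv_inl hΩ hF v (hz x)]
  simp

end ParametricIntegral

/-! ### The operators commute with the integral -/

section Operators

variable {n : ℕ} {W X : Type} [NormedAddCommGroup W] [NormedSpace ℝ W]
  [TopologicalSpace X] [CompactSpace X] [SecondCountableTopology X] [MeasurableSpace X]
  [BorelSpace X] {μ : Measure X} {ψ : X → ℂ} {ι : X → W} {Ω : Set ((Fin n → ℂ) × W)}
  {U : Set (Fin n → ℂ)}

lemma contDiffOn_wirtingerBar {F : (Fin n → ℂ) × W → ℂ} {m : ℕ} (hΩ : IsOpen Ω)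
    (hF : ContDiffOn ℝ (m + 1) F Ω) (j : Fin n) :
    ContDiffOn ℝ m (fun q : (Fin n → ℂ) × W => wirtingerBar j (fun y => F (y, q.2)) q.1) Ω := by
  unfold wirtingerBar
  exact ((contDiffOn_lineDeriv hΩ hF _).add
    (contDiffOn_const.mul (contDiffOn_lineDeriv hΩ hF _))).div_const 2

lemma contDiffOn_wirtinger {F : (Fin n → ℂ) × W → ℂ} {m : ℕ} (hΩ : IsOpen Ω)
    (hF : ContDiffOn ℝ (m + 1) F Ω) (j : Fin n) :
    ContDiffOn ℝ m (fun q : (Fin n → ℂ) × W => wirtinger j (fun y => F (y, q.2)) q.1) Ω := by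
  unfold wirtinger
  exact ((contDiffOn_lineDeriv hΩ hF _).sub
    (contDiffOn_const.mul (contDiffOn_lineDeriv hΩ hF _))).div_const 2

lemma wirtingerBar_integral {F : (Fin n → ℂ) × W → ℂ} (hΩ : IsOpen Ω)
    (hF : ContDiffOn ℝ 1 F Ω) (hι : Continuous ι) (hψ : Integrable ψ μ) {z : Fin n → ℂ}
    (hz : ∀ x, (z, ι x) ∈ Ω) (j : Fin n) :
    wirtingerBar j (fun y => ∫ x, ψ x • F (y, ι x) ∂μ) z =
      ∫ x, ψ x • wirtingerBar j (fun y => F (y, ι x)) z ∂μ := by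
  have hc : ∀ v, Integrable (fun x => ψ x • lineDeriv ℝ (fun y => F (y, ι x)) z v) μ := fun v =>
    integrable_smul_of_continuousOn (contDiffOn_lineDeriv (n := 0) hΩ (by simpa using hF)
      v).continuousOn hι hψ hz
  unfold wirtingerBar
  rw [lineDeriv_integral_smul hΩ hF hι hψ hz, lineDeriv_integral_smul hΩ hF hι hψ hz,
    ← integral_const_mul, ← integral_add (hc _) ((hc _).const_mul _), ← integral_div]
  refine integral_congr_ae (Eventually.of_forall fun x => ?_)
  simp only [smul_eq_mul]; ring

lemma wirtinger_integral {F : (Fin n → ℂ) × W → ℂ} (hΩ : IsOpen Ω)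
    (hF : ContDiffOn ℝ 1 F Ω) (hι : Continuous ι) (hψ : Integrable ψ μ) {z : Fin n → ℂ}
    (hz : ∀ x, (z, ι x) ∈ Ω) (j : Fin n) :
    wirtinger j (fun y => ∫ x, ψ x • F (y, ι x) ∂μ) z =
      ∫ x, ψ x • wirtinger j (fun y => F (y, ι x)) z ∂μ := by
  have hc : ∀ v, Integrable (fun x => ψ x • lineDeriv ℝ (fun y => F (y, ι x)) z v) μ := fun v =>
    integrable_smul_of_continuousOn (contDiffOn_lineDeriv (n := 0) hΩ (by simpa using hF)
      v).continuousOn hι hψ hz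
  unfold wirtinger
  rw [lineDeriv_integral_smul hΩ hF hι hψ hz, lineDeriv_integral_smul hΩ hF hι hψ hz,
    ← integral_const_mul, ← integral_sub (hc _) ((hc _).const_mul _), ← integral_div]
  refine integral_congr_ae (Eventually.of_forall fun x => ?_)
  simp only [smul_eq_mul]; ring

lemma wirtinger_congr {u v : (Fin n → ℂ) → ℂ} {z : Fin n → ℂ} (h : u =ᶠ[𝓝 z] v) (j : Fin n) :
    wirtinger j u z = wirtinger j v z := by
  simp only [wirtinger, h.lineDeriv_eq]

lemma integral_linear_combination {Y : Type*} [MeasurableSpace Y] {ν : Measure Y}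
    {f₁ f₂ f₃ f₄ : Y → ℂ} (h₁ : Integrable f₁ ν) (h₂ : Integrable f₂ ν) (h₃ : Integrable f₃ ν)
    (h₄ : Integrable f₄ ν) (A B C D : ℂ) :
    ∫ x, (A * f₁ x + B * f₂ x + C * f₃ x - D * f₄ x) ∂ν =
      A * ∫ x, f₁ x ∂ν + B * ∫ x, f₂ x ∂ν + C * ∫ x, f₃ x ∂ν - D * ∫ x, f₄ x ∂ν := by
  rw [integral_sub (f := fun x => A * f₁ x + B * f₂ x + C * f₃ x)
      (((h₁.const_mul A).add (h₂.const_mul B)).add (h₃.const_mul C)) (h₄.const_mul D),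
    integral_add (f := fun x => A * f₁ x + B * f₂ x)
      ((h₁.const_mul A).add (h₂.const_mul B)) (h₃.const_mul C),
    integral_add (h₁.const_mul A) (h₂.const_mul B)]
  simp only [integral_const_mul]

lemma opL_integral {F : (Fin n → ℂ) × W → ℂ} (hΩ : IsOpen Ω) (hU : IsOpen U)
    (hF : ContDiffOn ℝ 2 F Ω) (hι : Continuous ι) (hψ : Integrable ψ μ)
    (hUΩ : ∀ z ∈ U, ∀ x, (z, ι x) ∈ Ω) {z : Fin n → ℂ} (hz : z ∈ U) (a b : ℂ) (j : Fin n) :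
    opL a b j (fun y => ∫ x, ψ x • F (y, ι x) ∂μ) z =
      ∫ x, ψ x • opL a b j (fun y => F (y, ι x)) z ∂μ := by
  have hF1 : ContDiffOn ℝ 1 F Ω := hF.of_le one_le_two
  have hF2 : ContDiffOn ℝ ((1 : ℕ) + 1) F Ω := by
    convert hF using 1; norm_num
  have hF0 : ContDiffOn ℝ ((0 : ℕ) + 1) F Ω := by simpa using hF1
  have hD := contDiffOn_wirtingerBar hΩ hF2 j
  have hD1 : ContDiffOn ℝ 1
      (fun q : (Fin n → ℂ) × W => wirtingerBar j (fun y => F (y, q.2)) q.1) Ω := by simpa using hD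
  have e1 : wirtinger j (wirtingerBar j (fun y => ∫ x, ψ x • F (y, ι x) ∂μ)) z =
      ∫ x, ψ x • wirtinger j (wirtingerBar j (fun y => F (y, ι x))) z ∂μ := by
    -- The outer derivative depends on the inner one near `z`, so the exchange must first hold on a
    -- whole neighbourhood.
    rw [wirtinger_congr (v := fun y => ∫ x, ψ x • wirtingerBar j (fun y => F (y, ι x)) y ∂μ)]
    · exact wirtinger_integral hΩ hD1 hι hψ (hUΩ z hz) j
    · filter_upwards [hU.mem_nhds hz] with y hy
      exact wirtingerBar_integral hΩ hF1 hι hψ (hUΩ y hy) j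
  have hDD := (contDiffOn_wirtinger (m := 0) hΩ (by simpa using hD1) j).continuousOn
  have hd := (contDiffOn_wirtinger hΩ hF0 j).continuousOn
  have i1 : Integrable (fun x => ψ x • wirtinger j (wirtingerBar j (fun y => F (y, ι x))) z) μ :=
    integrable_smul_of_continuousOn hDD hι hψ (hUΩ z hz)
  have i2 : Integrable (fun x => ψ x • wirtinger j (fun y => F (y, ι x)) z) μ :=
    integrable_smul_of_continuousOn hd hι hψ (hUΩ z hz)
  have i3 : Integrable (fun x => ψ x • wirtingerBar j (fun y => F (y, ι x)) z) μ :=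
    integrable_smul_of_continuousOn hD1.continuousOn hι hψ (hUΩ z hz)
  have i4 : Integrable (fun x => ψ x • F (z, ι x)) μ :=
    integrable_smul_of_continuousOn hF.continuousOn hι hψ (hUΩ z hz)
  unfold opL
  rw [e1, wirtinger_integral hΩ hF1 hι hψ (hUΩ z hz), wirtingerBar_integral hΩ hF1 hι hψ (hUΩ z hz)]
  rw [← integral_linear_combination i1 i2 i3 i4]
  refine integral_congr_ae (Eventually.of_forall fun x => ?_)
  simp only [smul_eq_mul]; ring

end Operators

/-! ### Wirtinger calculus and the equation for the kernel -/

/-- `h` is real differentiable at `x`, with `∂h = p` and `∂̄h = q` there. -/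
def HasWirtingerAt (h : ℂ → ℂ) (p q x : ℂ) : Prop :=
  HasFDerivAt h (p • (1 : ℂ →L[ℝ] ℂ) + q • (Complex.conjCLE : ℂ →L[ℝ] ℂ)) x

namespace HasWirtingerAt

variable {g h : ℂ → ℂ} {p q p' q' x : ℂ}

lemma congr_deriv {f' : ℂ →L[ℝ] ℂ} (hf : HasFDerivAt h f' x)
    (e : ∀ v, f' v = p * v + q * (starRingEnd ℂ) v) : HasWirtingerAt h p q x := by
  have : f' = p • (1 : ℂ →L[ℝ] ℂ) + q • (Complex.conjCLE : ℂ →L[ℝ] ℂ) := by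
    ext v; simp [e]
  rw [HasWirtingerAt, ← this]
  exact hf

lemma congr_left (hh : HasWirtingerAt h p q x) (e : p = p') : HasWirtingerAt h p' q x := e ▸ hh

lemma id (x : ℂ) : HasWirtingerAt (fun y => y) 1 0 x :=
  congr_deriv (hasFDerivAt_id x) (by simp)

lemma conj (x : ℂ) : HasWirtingerAt (fun y => (starRingEnd ℂ) y) 0 1 x :=
  congr_deriv (Complex.conjCLE.hasFDerivAt) (by simp)

lemma const (c x : ℂ) : HasWirtingerAt (fun _ => c) 0 0 x :=
  congr_deriv (hasFDerivAt_const c x) (by simp)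

lemma add (hg : HasWirtingerAt g p q x) (hh : HasWirtingerAt h p' q' x) :
    HasWirtingerAt (fun y => g y + h y) (p + p') (q + q') x :=
  congr_deriv (HasFDerivAt.add hg hh) (by intro v; simp; ring)

lemma sub (hg : HasWirtingerAt g p q x) (hh : HasWirtingerAt h p' q' x) :
    HasWirtingerAt (fun y => g y - h y) (p - p') (q - q') x :=
  congr_deriv (HasFDerivAt.sub hg hh) (by intro v; simp; ring)

lemma mul (hg : HasWirtingerAt g p q x) (hh : HasWirtingerAt h p' q' x) :
    HasWirtingerAt (fun y => g y * h y) (p * h x + g x * p') (q * h x + g x * q') x :=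
  congr_deriv (HasFDerivAt.mul hg hh) (by intro v; simp; ring)

lemma comp {φ : ℂ → ℂ} {φ' : ℂ} (hφ : HasDerivAt φ φ' (h x)) (hh : HasWirtingerAt h p q x) :
    HasWirtingerAt (fun y => φ (h y)) (φ' * p) (φ' * q) x := by
  have := (hφ.hasFDerivAt.restrictScalars ℝ).comp x hh
  exact congr_deriv this (by intro v; simp; ring)

lemma cpow (hh : HasWirtingerAt h p q x) (hx : h x ∈ Complex.slitPlane) (s : ℂ) :
    HasWirtingerAt (fun y => h y ^ s) (h x ^ s * (s * p / h x)) (h x ^ s * (s * q / h x)) x := by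
  have hx0 := Complex.slitPlane_ne_zero hx
  have hd := (hasDerivAt_id (h x)).cpow_const (c := s) hx
  have := comp hd hh
  simp only [_root_.id] at this
  convert this using 1
  · rw [Complex.cpow_sub _ _ hx0, Complex.cpow_one]; field_simp
  · rw [Complex.cpow_sub _ _ hx0, Complex.cpow_one]; field_simp

lemma inv (hh : HasWirtingerAt h p q x) (hx : h x ≠ 0) :
    HasWirtingerAt (fun y => (h y)⁻¹) (-p / h x ^ 2) (-q / h x ^ 2) x := by
  convert comp (hasDerivAt_inv hx) hh using 1 <;> ring

/-- Only the slice in the variable `z j` matters; `C` absorbs the factors of a product that do not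
involve it. -/
lemma lineDeriv_single_eq {n : ℕ} {u : (Fin n → ℂ) → ℂ} {z : Fin n → ℂ} {j : Fin n} {C : ℂ}
    (hh : HasWirtingerAt h p q (z j))
    (hu : ∀ᶠ x in 𝓝 (z j), u (Function.update z j x) = C * h x) (v : ℂ) :
    lineDeriv ℝ u z (Pi.single j v) = C * (p * v + q * (starRingEnd ℂ) v) := by
  have hl := (HasFDerivAt.hasLineDerivAt hh v).const_mul C
  have e : (p • (1 : ℂ →L[ℝ] ℂ) + q • (Complex.conjCLE : ℂ →L[ℝ] ℂ)) v =
      p * v + q * (starRingEnd ℂ) v := by simp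
  rw [e] at hl
  refine HasLineDerivAt.lineDeriv ?_
  unfold HasLineDerivAt
  refine HasDerivAt.congr_of_eventuallyEq hl ?_
  have hc : Tendsto (fun t : ℝ => z j + t • v) (𝓝 0) (𝓝 (z j)) := by
    have : Continuous fun t : ℝ => z j + t • v := by fun_prop
    simpa using this.tendsto 0
  filter_upwards [hc.eventually hu] with t ht
  rw [← ht]
  congr 1
  ext i
  by_cases hi : i = j
  · subst hi; simp
  · simp [hi]

lemma wirtinger_eq {n : ℕ} {u : (Fin n → ℂ) → ℂ} {z : Fin n → ℂ} {j : Fin n} {C : ℂ}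
    (hh : HasWirtingerAt h p q (z j))
    (hu : ∀ᶠ x in 𝓝 (z j), u (Function.update z j x) = C * h x) :
    wirtinger j u z = C * p := by
  rw [wirtinger, hh.lineDeriv_single_eq hu, hh.lineDeriv_single_eq hu]
  simp
  linear_combination (-(C * p) / 2 + C * q / 2) * Complex.I_mul_I

lemma wirtingerBar_eq {n : ℕ} {u : (Fin n → ℂ) → ℂ} {z : Fin n → ℂ} {j : Fin n} {C : ℂ}
    (hh : HasWirtingerAt h p q (z j))
    (hu : ∀ᶠ x in 𝓝 (z j), u (Function.update z j x) = C * h x) :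
    wirtingerBar j u z = C * q := by
  rw [wirtingerBar, hh.lineDeriv_single_eq hu, hh.lineDeriv_single_eq hu]
  simp
  linear_combination ((C * p) / 2 - C * q / 2) * Complex.I_mul_I

end HasWirtingerAt

lemma ofReal_one_sub_norm_sq (z : ℂ) :
    ((1 - ‖z‖ ^ 2 : ℝ) : ℂ) = 1 - z * (starRingEnd ℂ) z := by
  rw [Complex.mul_conj, Complex.normSq_eq_norm_sq]; push_cast; rfl

lemma kernel_eq (a b z ξ : ℂ) : kernel a b z ξ =
    coef a b * ((1 - z * (starRingEnd ℂ) z) ^ (a + b + 1) *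
      ((1 - z * (starRingEnd ℂ) ξ) ^ (-(a + 1)) * (1 - (starRingEnd ℂ) z * ξ) ^ (-(b + 1)))) := by
  rw [kernel, ofReal_one_sub_norm_sq, Complex.cpow_neg, Complex.cpow_neg, ← mul_inv, div_eq_mul_inv]

/-- The logarithmic `∂`-derivative of the kernel. -/
def logDz (a b z ξ : ℂ) : ℂ :=
  -(a + b + 1) * (starRingEnd ℂ) z * (1 - z * (starRingEnd ℂ) z)⁻¹ +
    (a + 1) * (starRingEnd ℂ) ξ * (1 - z * (starRingEnd ℂ) ξ)⁻¹

/-- The logarithmic `∂̄`-derivative of the kernel. -/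
def logDzBar (a b z ξ : ℂ) : ℂ :=
  -(a + b + 1) * z * (1 - z * (starRingEnd ℂ) z)⁻¹ + (b + 1) * ξ * (1 - (starRingEnd ℂ) z * ξ)⁻¹

lemma one_sub_mul_re_pos {z w : ℂ} (hz : ‖z‖ < 1) (hw : ‖w‖ ≤ 1) : 0 < (1 - z * w).re :=
  one_sub_re_pos (by
    rw [norm_mul]
    exact (mul_le_of_le_one_right (norm_nonneg z) hw).trans_lt hz)

/-- Writing derivatives as kernel times logarithmic derivative lets the kernel factor out of the
equation, leaving no complex powers. -/
lemma hasWirtingerAt_kernel (a b : ℂ) {z ξ : ℂ} (hz : ‖z‖ < 1) (hξ : ‖ξ‖ = 1) :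
    HasWirtingerAt (fun y => kernel a b y ξ) (kernel a b z ξ * logDz a b z ξ)
      (kernel a b z ξ * logDzBar a b z ξ) z := by
  have s0 : 1 - z * (starRingEnd ℂ) z ∈ Complex.slitPlane :=
    Or.inl (one_sub_mul_re_pos hz (by simpa using hz.le))
  have s1 : 1 - z * (starRingEnd ℂ) ξ ∈ Complex.slitPlane :=
    Or.inl (one_sub_mul_re_pos hz (by simp [hξ]))
  have s2 : 1 - (starRingEnd ℂ) z * ξ ∈ Complex.slitPlane :=
    Or.inl (one_sub_mul_re_pos (by simpa using hz) hξ.le)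
  simp_rw [kernel_eq]
  have h0 := ((HasWirtingerAt.const 1 z).sub ((HasWirtingerAt.id z).mul
    (HasWirtingerAt.conj z))).cpow s0 (a + b + 1)
  have h1 := ((HasWirtingerAt.const 1 z).sub ((HasWirtingerAt.id z).mul
    (HasWirtingerAt.const ((starRingEnd ℂ) ξ) z))).cpow s1 (-(a + 1))
  have h2 := ((HasWirtingerAt.const 1 z).sub ((HasWirtingerAt.conj z).mul
    (HasWirtingerAt.const ξ z))).cpow s2 (-(b + 1))
  have h := (HasWirtingerAt.const (coef a b) z).mul (h0.mul (h1.mul h2))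
  convert h using 1
  · simp only [logDz]; ring
  · simp only [logDzBar]; ring

/-- The second summand of `logDzBar` is antiholomorphic in $z$, so only the first contributes to
$\partial$. The $\bar\partial$-part never enters the operator and is left unspecified. -/
lemma hasWirtingerAt_logDzBar (a b : ℂ) {z ξ : ℂ} (hz : ‖z‖ < 1) (hξ : ‖ξ‖ = 1) :
    ∃ q, HasWirtingerAt (fun y => logDzBar a b y ξ)
      (-(a + b + 1) * ((1 - z * (starRingEnd ℂ) z) ^ 2)⁻¹) q z := by
  have s0 : 1 - z * (starRingEnd ℂ) z ≠ 0 := Complex.slitPlane_ne_zero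
    (Or.inl (one_sub_mul_re_pos hz (by simpa using hz.le)))
  have s2 : 1 - (starRingEnd ℂ) z * ξ ≠ 0 := Complex.slitPlane_ne_zero
    (Or.inl (one_sub_mul_re_pos (by simpa using hz) hξ.le))
  have h0 := ((HasWirtingerAt.const 1 z).sub ((HasWirtingerAt.id z).mul
    (HasWirtingerAt.conj z))).inv s0
  have h2 := ((HasWirtingerAt.const 1 z).sub ((HasWirtingerAt.conj z).mul
    (HasWirtingerAt.const ξ z))).inv s2
  have h := (((HasWirtingerAt.const (-(a + b + 1)) z).mul (HasWirtingerAt.id z)).mul h0).add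
    ((HasWirtingerAt.const ((b + 1) * ξ) z).mul h2)
  refine ⟨_, HasWirtingerAt.congr_left h ?_⟩
  field_simp
  ring

lemma kernel_annihilated (a b : ℂ) {z ξ : ℂ} (hz : ‖z‖ < 1) (hξ : ‖ξ‖ = 1) :
    (1 - z * (starRingEnd ℂ) z) * (logDz a b z ξ * logDzBar a b z ξ +
        -(a + b + 1) * ((1 - z * (starRingEnd ℂ) z) ^ 2)⁻¹) +
      a * z * logDz a b z ξ + b * (starRingEnd ℂ) z * logDzBar a b z ξ - a * b = 0 := by
  have s0 : 1 - z * (starRingEnd ℂ) z ≠ 0 := Complex.slitPlane_ne_zero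
    (Or.inl (one_sub_mul_re_pos hz (by simpa using hz.le)))
  have s2 : 1 - (starRingEnd ℂ) z * ξ ≠ 0 := Complex.slitPlane_ne_zero
    (Or.inl (one_sub_mul_re_pos (by simpa using hz) hξ.le))
  have hξ0 : ξ ≠ 0 := fun h => by simp [h] at hξ
  have s1 : ξ - z ≠ 0 := fun h => by
    rw [← sub_eq_zero.1 h, hξ] at hz
    exact lt_irrefl _ hz
  have hc : (starRingEnd ℂ) ξ = ξ⁻¹ := by
    rw [Complex.inv_def, Complex.normSq_eq_norm_sq, hξ]; simp
  have e : (starRingEnd ℂ) ξ * (1 - z * (starRingEnd ℂ) ξ)⁻¹ = (ξ - z)⁻¹ := by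
    rw [hc, ← mul_inv]
    congr 1
    field_simp
  simp only [logDz, logDzBar, mul_assoc, e]
  -- Once $\bar\xi=\xi^{-1}$ has been used, $\bar z$ may be treated as an independent variable: what
  -- remains is a rational identity.
  generalize (starRingEnd ℂ) z = y at *
  field_simp
  ring

lemma opL_prod_kernel {n : ℕ} (α β : Fin n → ℂ) (j : Fin n) {z ζ : Fin n → ℂ}
    (hz : z ∈ polydisc n) (hζ : ∀ j, ‖ζ j‖ = 1) :
    opL (α j) (β j) j (fun y => ∏ i, kernel (α i) (β i) (y i) (ζ i)) z = 0 := by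
  classical
  set C : (Fin n → ℂ) → ℂ :=
    fun y => ∏ i ∈ Finset.univ.erase j, kernel (α i) (β i) (y i) (ζ i) with hC
  set u : (Fin n → ℂ) → ℂ := fun y => ∏ i, kernel (α i) (β i) (y i) (ζ i) with hu
  have hCu : ∀ y x, C (Function.update y j x) = C y := fun y x =>
    Finset.prod_congr rfl fun i hi => by
      rw [Function.update_of_ne (Finset.ne_of_mem_erase hi)]
  have huC : ∀ y, u y = C y * kernel (α j) (β j) (y j) (ζ j) := fun y =>
    (Finset.prod_erase_mul _ _ (Finset.mem_univ j)).symm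
  have huu : ∀ y x, u (Function.update y j x) = C y * kernel (α j) (β j) x (ζ j) := fun y x => by
    rw [huC, hCu, Function.update_self]
  have hk : ∀ y ∈ polydisc n, HasWirtingerAt (fun x => kernel (α j) (β j) x (ζ j)) _ _ (y j) :=
    fun y hy => hasWirtingerAt_kernel (α j) (β j) (hy j) (hζ j)
  have hbar : ∀ y ∈ polydisc n, wirtingerBar j u y =
      C y * (kernel (α j) (β j) (y j) (ζ j) * logDzBar (α j) (β j) (y j) (ζ j)) := fun y hy =>
    (hk y hy).wirtingerBar_eq (Eventually.of_forall (huu y))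
  have hd := (hk z hz).wirtinger_eq (Eventually.of_forall (huu z))
  obtain ⟨q, hq⟩ := hasWirtingerAt_logDzBar (α j) (β j) (hz j) (hζ j)
  have hbar2 : ∀ᶠ x in 𝓝 (z j), wirtingerBar j u (Function.update z j x) =
      C z * (kernel (α j) (β j) x (ζ j) * logDzBar (α j) (β j) x (ζ j)) := by
    filter_upwards [(isOpen_lt continuous_norm continuous_const).mem_nhds (hz j)] with x hx
    rw [hbar, hCu, Function.update_self]
    intro i
    by_cases hi : i = j
    · subst hi; simpa using hx
    · simpa [hi] using hz i
  have hdd := ((hk z hz).mul hq).wirtinger_eq hbar2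
  rw [opL, hdd, hd, hbar z hz, huC z, ofReal_one_sub_norm_sq]
  linear_combination (C z * kernel (α j) (β j) (z j) (ζ j)) *
    kernel_annihilated (α j) (β j) (hz j) (hζ j)

/-! ### Smoothness of the kernel and harmonicity of the Poisson integral -/

/-- A domain of joint smoothness of the kernel. -/
def kernelDomain (n : ℕ) : Set ((Fin n → ℂ) × (Fin n → ℂ)) :=
  {q | ∀ j, ‖q.1 j‖ < 1 ∧ 0 < (1 - q.1 j * (starRingEnd ℂ) (q.2 j)).re}

lemma isOpen_kernelDomain (n : ℕ) : IsOpen (kernelDomain n) := by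
  simp only [kernelDomain, Set.ofPred_forall, Set.ofPred_and]
  refine isOpen_iInter_of_finite fun j => IsOpen.inter ?_ ?_
  · exact isOpen_lt (by fun_prop) continuous_const
  · refine isOpen_lt continuous_const (Complex.continuous_re.comp ?_)
    exact continuous_const.sub (Continuous.mul (by fun_prop)
      (Complex.continuous_conj.comp (by fun_prop)))

lemma isOpen_polydisc (n : ℕ) : IsOpen (polydisc n) := by
  simp only [polydisc, Set.ofPred_forall]
  exact isOpen_iInter_of_finite fun j => isOpen_lt (by fun_prop) continuous_const

lemma contDiffAt_cpow {E : Type*} [NormedAddCommGroup E] [NormedSpace ℝ E] {f : E → ℂ} {x : E}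
    {m : ℕ} (hf : ContDiffAt ℝ m f x) (hx : f x ∈ Complex.slitPlane) (s : ℂ) :
    ContDiffAt ℝ m (fun y => f y ^ s) x := by
  have h : AnalyticAt ℂ (fun y : ℂ => y ^ s) (f x) := analyticAt_id.cpow analyticAt_const hx
  exact (h.contDiffAt.restrict_scalars ℝ).comp x hf

lemma contDiffOn_prod_kernel {n : ℕ} (α β : Fin n → ℂ) (m : ℕ) :
    ContDiffOn ℝ m (fun q : (Fin n → ℂ) × (Fin n → ℂ) =>
      ∏ i, kernel (α i) (β i) (q.1 i) (q.2 i)) (kernelDomain n) := by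
  refine contDiffOn_prod fun i _ => ?_
  intro q hq
  refine ContDiffAt.contDiffWithinAt ?_
  simp_rw [kernel_eq]
  obtain ⟨h1, h2⟩ := hq i
  have d1 : ContDiffAt ℝ m (fun q : (Fin n → ℂ) × (Fin n → ℂ) => q.1 i) q := by fun_prop
  have d2 : ContDiffAt ℝ m (fun q : (Fin n → ℂ) × (Fin n → ℂ) => q.2 i) q := by fun_prop
  have c1 : ContDiffAt ℝ m (fun q : (Fin n → ℂ) × (Fin n → ℂ) => (starRingEnd ℂ) (q.1 i)) q :=
    (Complex.conjCLE.contDiff.contDiffAt).comp q d1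
  have c2 : ContDiffAt ℝ m (fun q : (Fin n → ℂ) × (Fin n → ℂ) => (starRingEnd ℂ) (q.2 i)) q :=
    (Complex.conjCLE.contDiff.contDiffAt).comp q d2
  refine contDiffAt_const.mul ((contDiffAt_cpow (contDiffAt_const.sub (d1.mul c1)) ?_ _).mul
    ((contDiffAt_cpow (contDiffAt_const.sub (d1.mul c2)) (Or.inl h2) _).mul
      (contDiffAt_cpow (contDiffAt_const.sub (c1.mul d2)) (Or.inl ?_) _)))
  · exact Or.inl (one_sub_mul_re_pos h1 (by simpa using h1.le))
  -- The second base is the conjugate of the first, so one half-plane condition covers both.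
  · convert h2 using 1
    simp

lemma isSepHarmonic_poissonIntegral {n : ℕ} (α β : Fin n → ℂ) {ψ : Torus n → ℂ}
    (hψ : Integrable ψ (torusHaar n)) : IsSepHarmonic α β (poissonIntegral α β ψ) := by
  set F : (Fin n → ℂ) × (Fin n → ℂ) → ℂ :=
    fun q => ∏ i, kernel (α i) (β i) (q.1 i) (q.2 i) with hF
  have hu : poissonIntegral α β ψ = fun y =>
      ∫ ζ, ψ ζ • F (y, fun j => (ζ j : ℂ)) ∂(torusHaar n) := by
    funext z
    simp only [poissonIntegral, poissonKernel_eq_prod, hF, smul_eq_mul]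
    congr 1 with ζ
    ring
  have hι : Continuous fun (ζ : Torus n) j => (ζ j : ℂ) :=
    continuous_pi fun j => continuous_subtype_val.comp (continuous_apply j)
  have hUΩ : ∀ z ∈ polydisc n, ∀ ζ : Torus n, (z, fun j => (ζ j : ℂ)) ∈ kernelDomain n :=
    fun z hz ζ j => ⟨hz j, one_sub_mul_re_pos (hz j) (by simp [Circle.norm_coe (ζ j)])⟩
  have hF2 : ContDiffOn ℝ 2 F (kernelDomain n) := contDiffOn_prod_kernel α β 2
  rw [hu]
  refine ⟨contDiffOn_integral_smul 2 (isOpen_kernelDomain n) (isOpen_polydisc n) hF2 hι hψ hUΩ,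
    fun j z hz => ?_⟩
  rw [opL_integral (isOpen_kernelDomain n) (isOpen_polydisc n) hF2 hι hψ hUΩ hz]
  have : ∀ ζ : Torus n, opL (α j) (β j) j (fun y => F (y, fun j => (ζ j : ℂ))) z = 0 := fun ζ =>
    opL_prod_kernel α β j hz fun j => Circle.norm_coe (ζ j)
  simp [this]

/-! ### Jensen's and Young's inequalities -/

section Convolution

/-- Jensen's inequality for the measure with density `K`. -/
lemma lintegral_mul_rpow_le {X : Type*} [MeasurableSpace X] {μ : Measure X} {K f : X → ℝ≥0∞}
    (hK : AEMeasurable K μ) (hf : AEMeasurable f μ) {q : ℝ} (hq : 1 ≤ q) :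
    (∫⁻ x, K x * f x ∂μ) ^ q ≤ (∫⁻ x, K x ∂μ) ^ (q - 1) * ∫⁻ x, K x * f x ^ q ∂μ := by
  have hq0 : 0 < q := by linarith
  have hinv : q⁻¹ ≤ 1 := inv_le_one_of_one_le₀ hq
  -- Hölder's inequality for the factorisation $Kf=K^{1-1/q}(Kf^q)^{1/q}$.
  have h := ENNReal.lintegral_mul_norm_pow_le (μ := μ) hK (hK.mul (hf.pow_const q))
    (p := 1 - q⁻¹) (q := q⁻¹) (by linarith) (by positivity) (by ring)
  have e : ∀ x, K x ^ (1 - q⁻¹) * (K x * f x ^ q) ^ q⁻¹ = K x * f x := by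
    intro x
    rw [ENNReal.mul_rpow_of_nonneg _ _ (by positivity), ← mul_assoc,
      ← ENNReal.rpow_add_of_nonneg _ _ (by linarith) (by positivity), ← ENNReal.rpow_mul,
      mul_inv_cancel₀ hq0.ne']
    simp
  simp only [Pi.mul_apply, e] at h
  refine (ENNReal.rpow_le_rpow h hq0.le).trans_eq ?_
  rw [ENNReal.mul_rpow_of_nonneg _ _ hq0.le, ← ENNReal.rpow_mul, ← ENNReal.rpow_mul,
    inv_mul_cancel₀ hq0.ne', sub_mul, inv_mul_cancel₀ hq0.ne', one_mul, ENNReal.rpow_one]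

variable {G : Type*} [CommGroup G] [MeasurableSpace G] [MeasurableMul₂ G] {μ : Measure G}
  [μ.IsMulLeftInvariant]

lemma integral_mul_translate_congr {k ψ φ : G → ℂ} (h : ψ =ᵐ[μ] φ) (ζ : G) :
    ∫ ξ, k ξ * ψ (ζ * ξ) ∂μ = ∫ ξ, k ξ * φ (ζ * ξ) ∂μ := by
  refine integral_congr_ae ?_
  filter_upwards [(measurePreserving_mul_left μ ζ).quasiMeasurePreserving.ae_eq_comp h] with ξ hξ
  simp only [Function.comp] at hξ
  rw [hξ]

lemma enorm_integral_mul_translate_le {k ψ : G → ℂ} (hk : AEStronglyMeasurable k μ) (ζ : G) :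
    ‖∫ ξ, k ξ * ψ (ζ * ξ) ∂μ‖ₑ ≤ (∫⁻ ξ, ‖k ξ‖ₑ ∂μ) * eLpNorm ψ ∞ μ := by
  rw [← lintegral_mul_const'' _ hk.enorm]
  refine (enorm_integral_le_lintegral_enorm _).trans (lintegral_mono_ae ?_)
  have h : ∀ᵐ ξ ∂μ, ‖ψ ξ‖ₑ ≤ eLpNorm ψ ∞ μ := by
    rw [eLpNorm_exponent_top]; exact enorm_ae_le_eLpNormEssSup ψ μ
  filter_upwards [(measurePreserving_mul_left μ ζ).quasiMeasurePreserving.ae h] with ξ hξ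
  rw [enorm_mul]
  gcongr

/-- Young's inequality for the convolution of an integrable and an `L^p` function. -/
lemma eLpNorm_integral_mul_translate_le [SFinite μ] {k ψ : G → ℂ} (hk : AEStronglyMeasurable k μ)
    (hψ : AEStronglyMeasurable ψ μ) {p : ℝ≥0∞} (hp : 1 ≤ p) (hp' : p ≠ ∞) :
    eLpNorm (fun ζ => ∫ ξ, k ξ * ψ (ζ * ξ) ∂μ) p μ ≤ (∫⁻ ξ, ‖k ξ‖ₑ ∂μ) * eLpNorm ψ p μ := by
  -- Tonelli needs $(\zeta,\xi)\mapsto\psi(\zeta\xi)$ to be measurable on the product; a strongly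
  -- measurable representative gives the same integrals because translations preserve null sets.
  wlog hm : StronglyMeasurable ψ generalizing ψ
  · have h := this hψ.stronglyMeasurable_mk.aestronglyMeasurable hψ.stronglyMeasurable_mk
    rw [← eLpNorm_congr_ae hψ.ae_eq_mk] at h
    simpa only [← integral_mul_translate_congr hψ.ae_eq_mk] using h
  have hp0 : p ≠ 0 := (zero_lt_one.trans_le hp).ne'
  set q : ℝ := p.toReal with hq
  have hq1 : 1 ≤ q := by
    have := ENNReal.toReal_mono hp' hp
    simpa using this
  have hq0 : 0 < q := by linarith
  set M : ℝ≥0∞ := ∫⁻ ξ, ‖k ξ‖ₑ ∂μ with hM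
  have hψm : Measurable ψ := hm.measurable
  have hkey : ∫⁻ ζ, ‖∫ ξ, k ξ * ψ (ζ * ξ) ∂μ‖ₑ ^ q ∂μ ≤ M ^ q * ∫⁻ ζ, ‖ψ ζ‖ₑ ^ q ∂μ := by
    calc ∫⁻ ζ, ‖∫ ξ, k ξ * ψ (ζ * ξ) ∂μ‖ₑ ^ q ∂μ
        ≤ ∫⁻ ζ, M ^ (q - 1) * ∫⁻ ξ, ‖k ξ‖ₑ * ‖ψ (ζ * ξ)‖ₑ ^ q ∂μ ∂μ := by
          refine lintegral_mono fun ζ => ?_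
          have h1 : ‖∫ ξ, k ξ * ψ (ζ * ξ) ∂μ‖ₑ ≤ ∫⁻ ξ, ‖k ξ‖ₑ * ‖ψ (ζ * ξ)‖ₑ ∂μ := by
            simpa only [enorm_mul] using enorm_integral_le_lintegral_enorm (μ := μ)
              fun ξ => k ξ * ψ (ζ * ξ)
          refine (ENNReal.rpow_le_rpow h1 hq0.le).trans ?_
          exact lintegral_mul_rpow_le hk.enorm
            (hψm.comp (measurable_const_mul ζ)).enorm.aemeasurable hq1
      _ ≤ M ^ (q - 1) * ∫⁻ ζ, ∫⁻ ξ, ‖k ξ‖ₑ * ‖ψ (ζ * ξ)‖ₑ ^ q ∂μ ∂μ := by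
          rw [lintegral_const_mul'']
          refine AEMeasurable.lintegral_prod_right' (f := fun x : G × G =>
            ‖k x.2‖ₑ * ‖ψ (x.1 * x.2)‖ₑ ^ q) ?_
          exact hk.enorm.comp_snd.mul
            ((hψm.comp measurable_mul).enorm.pow_const q).aemeasurable
      _ = M ^ (q - 1) * ∫⁻ ξ, ∫⁻ ζ, ‖k ξ‖ₑ * ‖ψ (ζ * ξ)‖ₑ ^ q ∂μ ∂μ := by
          rw [lintegral_lintegral_swap]
          exact hk.enorm.comp_snd.mul
            ((hψm.comp measurable_mul).enorm.pow_const q).aemeasurable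
      _ = M ^ (q - 1) * ∫⁻ ξ, ‖k ξ‖ₑ * ∫⁻ ζ, ‖ψ ζ‖ₑ ^ q ∂μ ∂μ := by
          congr 1
          refine lintegral_congr fun ξ => ?_
          rw [lintegral_const_mul _ (by fun_prop)]
          congr 1
          simp_rw [mul_comm _ ξ]
          exact lintegral_mul_left_eq_self (fun ζ => ‖ψ ζ‖ₑ ^ q) ξ
      _ = M ^ q * ∫⁻ ζ, ‖ψ ζ‖ₑ ^ q ∂μ := by
          rw [lintegral_mul_const'' _ hk.enorm, ← hM, ← mul_assoc]
          congr 1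
          nth_rewrite 2 [← ENNReal.rpow_one M]
          rw [← ENNReal.rpow_add_of_nonneg _ _ (by linarith) zero_le_one]
          congr 1; ring
  rw [eLpNorm_eq_lintegral_rpow_enorm_toReal hp0 hp', eLpNorm_eq_lintegral_rpow_enorm_toReal hp0 hp']
  refine (ENNReal.rpow_le_rpow hkey (by positivity)).trans_eq ?_
  rw [ENNReal.mul_rpow_of_nonneg _ _ (by positivity), ← ENNReal.rpow_mul, mul_one_div_cancel hq0.ne',
    ENNReal.rpow_one]

end Convolution

/-! ### The kernel on the torus as an approximate identity -/

section Torus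

variable {n : ℕ}

instance isHaarMeasure_torusHaar : (torusHaar n).IsHaarMeasure := by
  unfold torusHaar; infer_instance

instance isProbabilityMeasure_torusHaar : IsProbabilityMeasure (torusHaar n) := by
  unfold torusHaar; infer_instance

instance weaklyRegular_torusHaar : (torusHaar n).WeaklyRegular := by
  unfold torusHaar; infer_instance

lemma integral_prod_torusHaar {𝕜 : Type*} [RCLike 𝕜] (f : Fin n → Circle → 𝕜) :
    ∫ ξ : Torus n, ∏ j, f j (ξ j) ∂(torusHaar n) = ∏ j, ∫ ξ, f j ξ ∂circleHaar :=
  integral_fintype_prod_eq_prod f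

/-- The kernel at the point `r ∈ [0,1)ⁿ` of the polydisc. -/
def radialKernel (α β : Fin n → ℂ) (r : Fin n → ℝ) (ξ : Torus n) : ℂ :=
  poissonKernel α β (fun j => (r j : ℂ)) ξ

lemma radialKernel_eq_prod (α β : Fin n → ℂ) (r : Fin n → ℝ) (ξ : Torus n) :
    radialKernel α β r ξ = ∏ j, kernel (α j) (β j) (r j) (ξ j) := rfl

lemma norm_ofReal_lt_one {r : Fin n → ℝ} (hr : r ∈ multiRadii n) (j : Fin n) :
    ‖(r j : ℂ)‖ < 1 := by
  rw [Complex.norm_real, Real.norm_eq_abs, abs_of_nonneg (hr j).1]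
  exact (hr j).2

lemma continuous_radialKernel (α β : Fin n → ℂ) {r : Fin n → ℝ} (hr : r ∈ multiRadii n) :
    Continuous (radialKernel α β r) :=
  continuous_finsetProd Finset.univ fun j _ =>
    (continuous_kernel (α j) (β j) (norm_ofReal_lt_one hr j)).comp (continuous_apply j)

lemma integrable_of_continuous_torus {E : Type*} [NormedAddCommGroup E]
    {f : Torus n → E} (hf : Continuous f) : Integrable f (torusHaar n) :=
  hf.integrable_of_hasCompactSupport (HasCompactSupport.of_compactSpace f)

lemma kernel_rotate (a b : ℂ) (r : ℝ) (ζ ξ : Circle) :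
    kernel a b (r * (ζ : ℂ)) ((ζ * ξ : Circle) : ℂ) = kernel a b r ξ := by
  have hζ : (ζ : ℂ) * (starRingEnd ℂ) (ζ : ℂ) = 1 := by
    rw [Complex.mul_conj, Circle.normSq_coe]; simp
  have e1 : (r : ℂ) * (ζ : ℂ) * (starRingEnd ℂ) ((ζ * ξ : Circle) : ℂ) =
      r * (starRingEnd ℂ) (ξ : ℂ) := by
    rw [Circle.coe_mul, map_mul]
    linear_combination (r : ℂ) * (starRingEnd ℂ) (ξ : ℂ) * hζ
  have e2 : (starRingEnd ℂ) ((r : ℂ) * (ζ : ℂ)) * ((ζ * ξ : Circle) : ℂ) =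
      (starRingEnd ℂ) (r : ℂ) * (ξ : ℂ) := by
    rw [Circle.coe_mul, map_mul]
    linear_combination (starRingEnd ℂ) (r : ℂ) * (ξ : ℂ) * hζ
  have e3 : ‖(r : ℂ) * (ζ : ℂ)‖ = ‖(r : ℂ)‖ := by rw [norm_mul, Circle.norm_coe, mul_one]
  rw [kernel, kernel, e1, e2, e3]

/-- Substituting $\xi\mapsto\zeta\xi$ in the Haar integral removes $\zeta$ from the kernel by
`kernel_rotate`. -/
lemma dilate_poissonIntegral (α β : Fin n → ℂ) (ψ : Torus n → ℂ) (r : Fin n → ℝ) (ζ : Torus n) :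
    dilate r (poissonIntegral α β ψ) ζ =
      ∫ ξ, radialKernel α β r ξ * ψ (ζ * ξ) ∂(torusHaar n) := by
  rw [dilate, poissonIntegral, ← integral_mul_left_eq_self _ ζ]
  congr 1 with ξ
  rw [poissonKernel_eq_prod, radialKernel_eq_prod]
  congr 1
  exact Finset.prod_congr rfl fun j _ => kernel_rotate _ _ _ _ _

lemma constK_eq_prod (α β : Fin n → ℂ) : constK α β = ∏ j, kernelBound (α j) (β j) := by
  rw [constK, Finset.mul_sum, Real.exp_sum, ← Finset.prod_mul_distrib]
  refine Finset.prod_congr rfl fun j _ => ?_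
  rw [kernelBound, coef]; ring

lemma integral_norm_radialKernel_le {α β : Fin n → ℂ} (hre : ∀ j, -1 < (α j).re + (β j).re)
    {r : Fin n → ℝ} (hr : r ∈ multiRadii n) :
    ∫ ξ, ‖radialKernel α β r ξ‖ ∂(torusHaar n) ≤ constK α β := by
  simp_rw [radialKernel_eq_prod, norm_prod]
  rw [integral_prod_torusHaar fun j (ξ : Circle) => ‖kernel (α j) (β j) (r j) ξ‖, constK_eq_prod]
  exact Finset.prod_le_prod (fun j _ => integral_nonneg fun _ => norm_nonneg _) fun j _ =>
    integral_norm_kernel_le (hre j) (hr j).1 (hr j).2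

lemma lintegral_enorm_radialKernel_le {α β : Fin n → ℂ} (hre : ∀ j, -1 < (α j).re + (β j).re)
    {r : Fin n → ℝ} (hr : r ∈ multiRadii n) :
    ∫⁻ ξ, ‖radialKernel α β r ξ‖ₑ ∂(torusHaar n) ≤ ENNReal.ofReal (constK α β) := by
  rw [← ofReal_integral_norm_eq_lintegral_enorm
    (integrable_of_continuous_torus (continuous_radialKernel α β hr))]
  exact ENNReal.ofReal_le_ofReal (integral_norm_radialKernel_le hre hr)

lemma tendsto_apply_multiRadii (j : Fin n) :
    Tendsto (fun r : Fin n → ℝ => r j) (𝓝[multiRadii n] (fun _ => 1)) (𝓝[Set.Ico 0 1] 1) := by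
  refine tendsto_nhdsWithin_iff.2
    ⟨((continuous_apply j).tendsto (fun _ : Fin n => (1 : ℝ))).mono_left nhdsWithin_le_nhds, ?_⟩
  filter_upwards [self_mem_nhdsWithin] with r hr using hr j

lemma tendsto_integral_radialKernel {α β : Fin n → ℂ} (hre : ∀ j, -1 < (α j).re + (β j).re)
    (hα : ∀ j, ∀ k : ℕ, α j ≠ -((k : ℂ) + 1)) (hβ : ∀ j, ∀ k : ℕ, β j ≠ -((k : ℂ) + 1)) :
    Tendsto (fun r : Fin n → ℝ => ∫ ξ, radialKernel α β r ξ ∂(torusHaar n))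
      (𝓝[multiRadii n] (fun _ => 1)) (𝓝 1) := by
  simp_rw [radialKernel_eq_prod]
  have h := tendsto_finsetProd Finset.univ fun j _ =>
    (tendsto_integral_kernel (hre j) (hα j) (hβ j)).comp (tendsto_apply_multiRadii j)
  simp only [Finset.prod_const_one] at h
  refine h.congr fun r => ?_
  exact (integral_prod_torusHaar fun j (ξ : Circle) => kernel (α j) (β j) (r j) ξ).symm

/-- The integral factors: coordinate `j` gives a null factor, and the others are bounded by
`kernelBound` for every radius, which is why the radii may tend to $1$ at unrelated rates. -/
lemma tendsto_integral_indicator_radialKernel {α β : Fin n → ℂ}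
    (hre : ∀ j, -1 < (α j).re + (β j).re) {δ : ℝ} (hδ : 0 < δ) (j : Fin n) :
    Tendsto (fun r : Fin n → ℝ => ∫ ξ, {ξ : Torus n | δ ≤ ‖(ξ j : ℂ) - 1‖}.indicator
      (fun ξ => ‖radialKernel α β r ξ‖) ξ ∂(torusHaar n))
      (𝓝[multiRadii n] (fun _ => 1)) (𝓝 0) := by
  classical
  set S : Set Circle := {ξ : Circle | δ ≤ ‖(ξ : ℂ) - 1‖} with hS
  set f : (Fin n → ℝ) → Fin n → Circle → ℝ := fun r i =>
    if i = j then S.indicator (fun ξ : Circle => ‖kernel (α i) (β i) (r i) ξ‖)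
    else fun ξ : Circle => ‖kernel (α i) (β i) (r i) ξ‖ with hf
  have hprod : ∀ r ξ, {ξ : Torus n | δ ≤ ‖(ξ j : ℂ) - 1‖}.indicator
      (fun ξ => ‖radialKernel α β r ξ‖) ξ = ∏ i, f r i (ξ i) := by
    intro r ξ
    by_cases hξ : ξ j ∈ S
    · rw [Set.indicator_of_mem (by exact hξ), radialKernel_eq_prod, norm_prod]
      refine Finset.prod_congr rfl fun i _ => ?_
      by_cases hi : i = j
      · subst hi; simp [hf, hξ]
      · simp [hf, hi]
    · rw [Set.indicator_of_notMem (by exact hξ)]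
      exact (Finset.prod_eq_zero (Finset.mem_univ j) (by simp [hf, hξ])).symm
  simp_rw [hprod]
  have hint : ∀ r : Fin n → ℝ, ∫ ξ : Torus n, ∏ i, f r i (ξ i) ∂(torusHaar n) =
      (∏ i ∈ Finset.univ.erase j, ∫ ξ : Circle, ‖kernel (α i) (β i) (r i) ξ‖ ∂circleHaar) *
      ∫ ξ : Circle, S.indicator (fun ξ : Circle => ‖kernel (α j) (β j) (r j) ξ‖) ξ ∂circleHaar := by
    intro r
    rw [integral_prod_torusHaar, ← Finset.prod_erase_mul _ _ (Finset.mem_univ j)]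
    congr 1
    · refine Finset.prod_congr rfl fun i hi => ?_
      simp [hf, Finset.ne_of_mem_erase hi]
    · simp [hf]
  simp_rw [hint]
  have hlim := ((tendsto_integral_indicator_kernel (hre j) hδ).comp
    (tendsto_apply_multiRadii j)).const_mul
      (∏ i ∈ Finset.univ.erase j, kernelBound (α i) (β i))
  rw [mul_zero] at hlim
  refine squeeze_zero' (Eventually.of_forall fun r => ?_) ?_ hlim
  · exact mul_nonneg (Finset.prod_nonneg fun i _ => integral_nonneg fun _ => norm_nonneg _)
      (integral_nonneg fun _ => Set.indicator_nonneg (fun _ _ => norm_nonneg _) _)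
  · filter_upwards [self_mem_nhdsWithin] with r hr
    refine mul_le_mul_of_nonneg_right ?_
      (integral_nonneg fun _ => Set.indicator_nonneg (fun _ _ => norm_nonneg _) _)
    exact Finset.prod_le_prod (fun j _ => integral_nonneg fun _ => norm_nonneg _) fun j _ =>
      integral_norm_kernel_le (hre j) (hr j).1 (hr j).2

/-- Poisson integrals of continuous functions converge uniformly. -/
lemma eventually_norm_dilate_sub_le {α β : Fin n → ℂ} (hre : ∀ j, -1 < (α j).re + (β j).re)
    (hα : ∀ j, ∀ k : ℕ, α j ≠ -((k : ℂ) + 1)) (hβ : ∀ j, ∀ k : ℕ, β j ≠ -((k : ℂ) + 1))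
    {g : Torus n → ℂ} (hg : Continuous g) {ε : ℝ} (hε : 0 < ε) :
    ∀ᶠ r in 𝓝[multiRadii n] (fun _ => 1), ∀ ζ,
      ‖dilate r (poissonIntegral α β g) ζ - g ζ‖ ≤ ε := by
  have hK0 : 0 ≤ constK α β := (integral_nonneg fun _ => norm_nonneg _).trans
    (integral_norm_radialKernel_le hre (r := fun _ => 0) fun _ => ⟨le_rfl, one_pos⟩)
  -- Chosen so that `ε₁ * constK α β < ε`; the `+ 1` keeps the denominator positive.
  set ε₁ : ℝ := ε / 2 / (constK α β + 1) with hε₁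
  have hε₁0 : 0 < ε₁ := by positivity
  obtain ⟨M, hM⟩ := (isCompact_range hg).isBounded.exists_norm_le
  have hM' : ∀ ζ, ‖g ζ‖ ≤ M := fun ζ => hM _ ⟨ζ, rfl⟩
  have hM0 : 0 ≤ M := (norm_nonneg _).trans (hM' 1)
  obtain ⟨δ, hδ, hδg⟩ := Metric.uniformContinuous_iff.1
    (CompactSpace.uniformContinuous_of_continuous hg) ε₁ hε₁0
  set S : Fin n → Set (Torus n) := fun j => {ξ | δ ≤ ‖(ξ j : ℂ) - 1‖} with hS
  have hSm : ∀ j, MeasurableSet (S j) := fun j => by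
    have h1 : Continuous fun ξ : Torus n => (ξ j : ℂ) :=
      continuous_subtype_val.comp (continuous_apply j)
    exact (isClosed_le continuous_const (by fun_prop)).measurableSet
  -- If some coordinate of $\xi$ is at distance at least $\delta$ from $1$, the crude bound $2M$ is
  -- charged to the indicators; otherwise $\zeta\xi$ is $\delta$-close to $\zeta$ and uniform
  -- continuity applies.
  have hloc : ∀ (k : Torus n → ℂ) ζ ξ, ‖k ξ * (g (ζ * ξ) - g ζ)‖ ≤
      ε₁ * ‖k ξ‖ + 2 * M * ∑ j, (S j).indicator (fun ξ => ‖k ξ‖) ξ := by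
    intro k ζ ξ
    have hind : ∀ j, 0 ≤ (S j).indicator (fun ξ => ‖k ξ‖) ξ := fun j =>
      Set.indicator_nonneg (fun _ _ => norm_nonneg _) _
    rw [norm_mul]
    by_cases h : ∃ j, ξ j ∈ {ξ : Circle | δ ≤ ‖(ξ : ℂ) - 1‖}
    · obtain ⟨j, hj⟩ := h
      have h1 : ‖k ξ‖ ≤ ∑ j, (S j).indicator (fun ξ => ‖k ξ‖) ξ := by
        refine le_trans (le_of_eq ?_) (Finset.single_le_sum (fun j _ => hind j) (Finset.mem_univ j))
        rw [Set.indicator_of_mem (by exact hj)]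
      have h2 : ‖g (ζ * ξ) - g ζ‖ ≤ 2 * M := by
        have := norm_sub_le (g (ζ * ξ)) (g ζ)
        linarith [hM' (ζ * ξ), hM' ζ]
      have h3 := mul_le_mul h1 h2 (norm_nonneg _) ((norm_nonneg _).trans h1)
      have h4 : 0 ≤ ε₁ * ‖k ξ‖ := by positivity
      linarith
    · push Not at h
      have hd : dist (ζ * ξ) ζ < δ := by
        rw [dist_pi_lt_iff hδ]
        intro j
        have hj : ‖(ξ j : ℂ) - 1‖ < δ := not_le.1 (h j)
        have : dist ((ζ * ξ) j) (ζ j) = ‖(ξ j : ℂ) - 1‖ := by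
          have e : dist ((ζ * ξ) j) (ζ j) = dist (((ζ j * ξ j : Circle)) : ℂ) (ζ j : ℂ) := rfl
          rw [e, Circle.coe_mul, dist_eq_norm,
            show (ζ j : ℂ) * (ξ j : ℂ) - (ζ j : ℂ) = (ζ j : ℂ) * ((ξ j : ℂ) - 1) by ring, norm_mul,
            Circle.norm_coe, one_mul]
        rwa [this]
      have h1 := (hδg hd).le
      rw [dist_eq_norm] at h1
      have h2 := mul_le_mul_of_nonneg_left h1 (norm_nonneg (k ξ))
      have h3 : 0 ≤ 2 * M * ∑ j, (S j).indicator (fun ξ => ‖k ξ‖) ξ :=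
        mul_nonneg (by positivity) (Finset.sum_nonneg fun j _ => hind j)
      linarith
  have hlim : Tendsto (fun r : Fin n → ℝ => ε₁ * constK α β +
      2 * M * ∑ j, ∫ ξ, (S j).indicator (fun ξ => ‖radialKernel α β r ξ‖) ξ ∂(torusHaar n) +
      M * ‖∫ ξ, radialKernel α β r ξ ∂(torusHaar n) - 1‖)
      (𝓝[multiRadii n] (fun _ => 1)) (𝓝 (ε₁ * constK α β + 2 * M * ∑ j : Fin n, 0 + M * 0)) := by
    refine (tendsto_const_nhds.add ((tendsto_finsetSum _ fun j _ =>
      tendsto_integral_indicator_radialKernel hre hδ j).const_mul _)).add (Tendsto.const_mul _ ?_)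
    exact tendsto_iff_norm_sub_tendsto_zero.1 (tendsto_integral_radialKernel hre hα hβ)
  have hlt : ε₁ * constK α β + 2 * M * ∑ j : Fin n, (0 : ℝ) + M * 0 < ε := by
    simp only [Finset.sum_const_zero, mul_zero, add_zero, hε₁]
    rw [div_mul_eq_mul_div, div_lt_iff₀ (by positivity)]
    nlinarith
  filter_upwards [hlim.eventually (gt_mem_nhds hlt), self_mem_nhdsWithin] with r hr1 hr ζ
  refine le_trans ?_ hr1.le
  have hkc := continuous_radialKernel α β hr
  have hki := integrable_of_continuous_torus hkc
  have hgζ : Continuous fun ξ => g (ζ * ξ) := hg.comp (continuous_const.mul continuous_id)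
  -- The last term accounts for the mass of the kernel being $1$ only in the limit.
  have e : dilate r (poissonIntegral α β g) ζ - g ζ =
      ∫ ξ, radialKernel α β r ξ * (g (ζ * ξ) - g ζ) ∂(torusHaar n) +
        g ζ * (∫ ξ, radialKernel α β r ξ ∂(torusHaar n) - 1) := by
    have hi : Integrable (fun ξ => radialKernel α β r ξ * g (ζ * ξ)) (torusHaar n) :=
      integrable_of_continuous_torus (hkc.mul hgζ)
    simp_rw [mul_sub (radialKernel α β r _)]
    rw [dilate_poissonIntegral, integral_sub hi (hki.mul_const _), integral_mul_const]
    ring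
  rw [e]
  refine (norm_add_le _ _).trans (add_le_add ?_ ?_)
  · have hi1 : Integrable (fun ξ => ε₁ * ‖radialKernel α β r ξ‖) (torusHaar n) :=
      hki.norm.const_mul _
    have hi2 : ∀ j ∈ Finset.univ, Integrable
        (fun ξ => (S j).indicator (fun ξ => ‖radialKernel α β r ξ‖) ξ) (torusHaar n) :=
      fun j _ => hki.norm.indicator (hSm j)
    have hi3 : Integrable (fun ξ => 2 * M *
        ∑ j, (S j).indicator (fun ξ => ‖radialKernel α β r ξ‖) ξ) (torusHaar n) :=
      (integrable_finsetSum _ hi2).const_mul _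
    refine (norm_integral_le_of_norm_le (hi1.add hi3)
      (Eventually.of_forall fun ξ => hloc _ ζ ξ)).trans ?_
    simp only [Pi.add_apply]
    rw [integral_add hi1 hi3, integral_const_mul, integral_const_mul, integral_finsetSum _ hi2]
    gcongr
    exact integral_norm_radialKernel_le hre hr
  · rw [norm_mul]
    exact mul_le_mul_of_nonneg_right (hM' ζ) (norm_nonneg _)

lemma exists_dilate_eq {z : Fin n → ℂ} (hz : z ∈ polydisc n) :
    ∃ r ∈ multiRadii n, ∃ ζ : Torus n, ∀ u, dilate r u ζ = u z := by
  refine ⟨fun j => ‖z j‖, fun j => ⟨norm_nonneg _, hz j⟩, fun j => Circle.exp (z j).arg,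
    fun u => ?_⟩
  rw [dilate]
  congr 1
  ext j
  rw [Circle.coe_exp, Complex.norm_mul_exp_arg_mul_I]

lemma shNorm_poissonIntegral_le {α β : Fin n → ℂ} (hre : ∀ j, -1 < (α j).re + (β j).re)
    {p : ℝ≥0∞} (hp : 1 ≤ p) {ψ : Torus n → ℂ} (hψ : MemLp ψ p (torusHaar n)) :
    shNorm p (poissonIntegral α β ψ) ≤
      ENNReal.ofReal (constK α β) * eLpNorm ψ p (torusHaar n) := by
  rw [shNorm]
  split_ifs with h
  · subst h
    -- For $p=\infty$ the norm is a true supremum, so the estimate is made at each point, through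
    -- its polar coordinates.
    refine iSup₂_le fun z hz => ?_
    obtain ⟨r, hr, ζ, hζ⟩ := exists_dilate_eq hz
    rw [← hζ (poissonIntegral α β ψ), dilate_poissonIntegral]
    refine (enorm_integral_mul_translate_le
      (continuous_radialKernel α β hr).aestronglyMeasurable ζ).trans ?_
    gcongr
    exact lintegral_enorm_radialKernel_le hre hr
  · refine iSup₂_le fun r hr => ?_
    rw [show dilate r (poissonIntegral α β ψ) = _ from funext (dilate_poissonIntegral α β ψ r)]
    refine (eLpNorm_integral_mul_translate_le
      (continuous_radialKernel α β hr).aestronglyMeasurable hψ.aestronglyMeasurable hp h).trans ?_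
    gcongr
    exact lintegral_enorm_radialKernel_le hre hr

lemma continuous_dilate_poissonIntegral (α β : Fin n → ℂ) {ψ : Torus n → ℂ}
    (hψ : Integrable ψ (torusHaar n)) {r : Fin n → ℝ} (hr : r ∈ multiRadii n) :
    Continuous (dilate r (poissonIntegral α β ψ)) := by
  refine (isSepHarmonic_poissonIntegral α β hψ).1.continuousOn.comp_continuous
    (f := fun ζ : Torus n => fun j => (r j : ℂ) * (ζ j : ℂ)) ?_ fun ζ j => ?_
  · exact continuous_pi fun j =>
      continuous_const.mul (continuous_subtype_val.comp (continuous_apply j))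
  · rw [norm_mul, Circle.norm_coe, mul_one]
    exact norm_ofReal_lt_one hr j

lemma poissonIntegral_sub (α β : Fin n → ℂ) {ψ φ : Torus n → ℂ} (hψ : Integrable ψ (torusHaar n))
    (hφ : Integrable φ (torusHaar n)) {r : Fin n → ℝ} (hr : r ∈ multiRadii n) (ζ : Torus n) :
    dilate r (poissonIntegral α β (ψ - φ)) ζ =
      dilate r (poissonIntegral α β ψ) ζ - dilate r (poissonIntegral α β φ) ζ := by
  have hkc := continuous_radialKernel α β hr
  obtain ⟨C, hC⟩ := (isCompact_range hkc).isBounded.exists_norm_le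
  have hi : ∀ φ : Torus n → ℂ, Integrable φ (torusHaar n) →
      Integrable (fun ξ => radialKernel α β r ξ * φ (ζ * ξ)) (torusHaar n) := fun φ hφ =>
    (hφ.comp_mul_left ζ).bdd_mul hkc.aestronglyMeasurable
      (Eventually.of_forall fun ξ => hC _ ⟨ξ, rfl⟩)
  simp_rw [dilate_poissonIntegral]
  rw [← integral_sub (hi ψ hψ) (hi φ hφ)]
  congr 1 with ξ
  simp only [Pi.sub_apply]; ring

/-! ### Convergence in $L^p$ by density -/

lemma tendsto_eLpNorm_dilate_sub {α β : Fin n → ℂ} (hre : ∀ j, -1 < (α j).re + (β j).re)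
    (hα : ∀ j, ∀ k : ℕ, α j ≠ -((k : ℂ) + 1)) (hβ : ∀ j, ∀ k : ℕ, β j ≠ -((k : ℂ) + 1))
    {p : ℝ≥0∞} (hp : 1 ≤ p) (hp' : p ≠ ∞) {ψ : Torus n → ℂ} (hψ : MemLp ψ p (torusHaar n)) :
    Tendsto (fun r : Fin n → ℝ =>
      eLpNorm (fun ζ => dilate r (poissonIntegral α β ψ) ζ - ψ ζ) p (torusHaar n))
      (𝓝[multiRadii n] (fun _ => 1)) (𝓝 0) := by
  rw [ENNReal.tendsto_nhds_zero]
  intro ε hε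
  -- Three errors are summed: $K\eta$ from the Poisson integral of $\psi-g$ by Young, $\eta$ from
  -- uniform convergence for $g$, and $\eta$ from $g-\psi$.
  obtain ⟨η, hη0, hηε⟩ := ENNReal.exists_nnreal_pos_mul_lt
    (show ENNReal.ofReal (constK α β) + 1 + 1 ≠ ∞ by finiteness) hε.ne'
  have hη0' : (η : ℝ≥0∞) ≠ 0 := by exact_mod_cast hη0.ne'
  replace hηε : ENNReal.ofReal (constK α β) * η + η + η ≤ ε := by
    refine le_of_eq_of_le ?_ hηε.le
    ring
  obtain ⟨g, hg, hgp⟩ := hψ.exists_boundedContinuous_eLpNorm_sub_le hp' hη0'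
  have hψi := hψ.integrable hp
  have hgi := hgp.integrable hp
  filter_upwards [eventually_norm_dilate_sub_le hre hα hβ g.continuous (ε := η) hη0,
    self_mem_nhdsWithin] with r hr1 hr
  have hdm : ∀ φ : Torus n → ℂ, Integrable φ (torusHaar n) →
      AEStronglyMeasurable (dilate r (poissonIntegral α β φ)) (torusHaar n) := fun φ hφ =>
    (continuous_dilate_poissonIntegral α β hφ hr).aestronglyMeasurable
  have e : (fun ζ => dilate r (poissonIntegral α β ψ) ζ - ψ ζ) =
      dilate r (poissonIntegral α β (ψ - g)) +
        (fun ζ => dilate r (poissonIntegral α β g) ζ - g ζ) + (g - ψ) := by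
    funext ζ
    simp only [Pi.add_apply, Pi.sub_apply, poissonIntegral_sub α β hψi hgi hr]
    ring
  have hm1 := hdm _ (hψi.sub hgi)
  have hm2 := (hdm _ hgi).sub hgp.aestronglyMeasurable
  have hm3 := hgp.aestronglyMeasurable.sub hψ.aestronglyMeasurable
  rw [e]
  refine (eLpNorm_add_le (hm1.add hm2) hm3 hp).trans (le_trans ?_ hηε)
  refine add_le_add ((eLpNorm_add_le hm1 hm2 hp).trans (add_le_add ?_ ?_)) ?_
  · rw [show dilate r (poissonIntegral α β (ψ - g)) = _ from
      funext (dilate_poissonIntegral α β (ψ - g) r)]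
    refine (eLpNorm_integral_mul_translate_le
      (continuous_radialKernel α β hr).aestronglyMeasurable
      (hψ.aestronglyMeasurable.sub hgp.aestronglyMeasurable) hp hp').trans ?_
    gcongr
    exact lintegral_enorm_radialKernel_le hre hr
  -- The measure has mass one, so a uniform bound is an $L^p$ bound with the same constant.
  · refine (eLpNorm_le_of_ae_bound (Eventually.of_forall hr1)).trans ?_
    simp
  · rwa [eLpNorm_sub_comm]

end Torus

end SepHarm

end

theorem theorem3p11 (n : ℕ) (α β : Fin n → ℂ)
    (hre : ∀ j, -1 < (α j).re + (β j).re)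
    (hα : ∀ j, ∀ k : ℕ, α j ≠ -((k : ℂ) + 1))
    (hβ : ∀ j, ∀ k : ℕ, β j ≠ -((k : ℂ) + 1))
    (p : ℝ≥0∞) (hp : 1 ≤ p)
    (ψ : SepHarm.Torus n → ℂ) (hψ : MemLp ψ p (SepHarm.torusHaar n)) :
    (SepHarm.poissonIntegral α β ψ ∈ SepHarm.sh α β p ∧
      SepHarm.shNorm p (SepHarm.poissonIntegral α β ψ) ≤
        ENNReal.ofReal (SepHarm.constK α β) * eLpNorm ψ p (SepHarm.torusHaar n)) ∧
    (p ≠ ∞ →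
      Tendsto
        (fun r : Fin n → ℝ =>
          eLpNorm (fun ζ => SepHarm.dilate r (SepHarm.poissonIntegral α β ψ) ζ - ψ ζ) p
            (SepHarm.torusHaar n))
        (𝓝[SepHarm.multiRadii n] (fun _ => 1)) (𝓝 0)) := by
  have hle := SepHarm.shNorm_poissonIntegral_le hre hp hψ
  exact ⟨⟨⟨SepHarm.isSepHarmonic_poissonIntegral α β (hψ.integrable hp),
    hle.trans_lt (ENNReal.mul_lt_top ENNReal.ofReal_lt_top hψ.2)⟩, hle⟩,
    fun hp' => SepHarm.tendsto_eLpNorm_dilate_sub hre hα hβ hp hp' hψ⟩
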